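/- Let $\tau$ be in the upper half-plane, $q=e^{2\pi i\tau}$, and $\vartheta_4(z)=\sum_{n\in\mathbb Z}(-1)^nq^{n^2}e^{2niz}$; write $\vartheta_4^{(k)}(0)$ for the $k$-th derivative in $z$ at $z=0$. Let $\Phi_s(q)=\sum_{n\ge1}\frac{n^sq^n}{1-q^n}$, let $B_k$ be the Bernoulli numbers, and for even $k\ge2$ let $E_k(\tau)=1-\frac{2k}{B_k}\Phi_{k-1}(q)$. Let $P(q)=1-24\Phi_1(q)$, $Q(q)=1+240\Phi_3(q)$, $R(q)=1-504\Phi_5(q)$ (so that $E_2(\tau)=P(q)$). (i) One has $\vartheta_4(0)\neq0$, $\vartheta_4^{(k)}(0)=0$ for odd $k$, and for every $\nu=1,2,3,\dots$ $$\frac{(-1)^{\nu}}{2\cdot4^{\nu}}\sum\frac{(2\nu)!}{m_1!(1!)^{m_1}m_2!(2!)^{m_2}\cdots m_{2\nu}!((2\nu)!)^{m_{2\nu}}}\,\frac{(-1)^{M}\,\Gamma(M)}{\vartheta_4(0)^{M}}\prod_{j=1}^{2\nu}\left(\vartheta_4^{(j)}(0)\right)^{m_j}=\frac{B_{2\nu}}{4\nu}\left(E_{2\nu}(2\tau)-E_{2\nu}(\tau)\right),$$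 where the sum is over all tuples $(m_1,\dots,m_{2\nu})$ of nonnegative integers with $1m_1+2m_2+\cdots+2\nu\,m_{2\nu}=2\nu$, and $M=m_1+\cdots+m_{2\nu}$. This yields the recurrence $$\vartheta_4^{(2\nu)}(0)=\vartheta_4(0)\Big[(-1)^{\nu+1}\,2\cdot4^{\nu}\,\frac{B_{2\nu}}{4\nu}\left(E_{2\nu}(2\tau)-E_{2\nu}(\tau)\right)+\Sigma'\Big],$$ where $\Sigma'$ is the same sum as above (without the factor in front of it) restricted to the tuples with $m_{2\nu}=0$, so that it involves only derivatives of order less than $2\nu$. (ii) For every $\nu\ge1$ there are rational numbers $c_{ijklmn}$, depending only on $\nu$ and the indices, such that for every $\tau$ in the upper half-plane $$\vartheta_4^{(2\nu)}(0)=w\sum_{0\le i,j,k,l,m,n\le\nu}c_{ijklmn}\,P(q)^iQ(q)^jR(q)^kP(q^2)^lQ(q^2)^mR(q^2)^n .$$ Here $w$ is the square root $w=\vartheta_4(0)$ of $\frac2\pi(1-x)\mathbf K$, where $x=\theta_2^2/\theta_3^2$ and $\mathbf K=\frac\pi2\theta_3^2$ are the elliptic modulus and the complete elliptic integral of the first kind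 belonging to the nome $q^2$, as functions of $\tau$, with $\theta_2=\sum_{n\in\mathbb Z}e^{4\pi i\tau(n+1/2)^2}$ and $\theta_3=\sum_{n\in\mathbb Z}e^{4\pi i\tau n^2}$. If $0<q<1$, then there is exactly one $x\in(0,1)$ with $q^2=\exp\left(-\pi K(\sqrt{1-x^2})/K(x)\right)$, where $K(x)=\int_0^{\pi/2}\frac{d\varphi}{\sqrt{1-x^2\sin^2\varphi}}$; this number is the modulus $x$ above, $\mathbf K=K(x)$, and $w=\sqrt{\frac2\pi(1-x)K(x)}$ with the positive square root. -/

import Mathlib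

namespace ThetaDeriv

noncomputable section

/-- `q = e^{2πiτ}`. -/
def qParam (τ : ℂ) : ℂ := Complex.exp (2 * Real.pi * Complex.I * τ)

/-- `ϑ₄(z) = ∑_{n ∈ ℤ} (-1)ⁿ q^{n²} e^{2niz}` with `q = e^{2πiτ}`. -/
def theta4 (τ z : ℂ) : ℂ :=
  ∑' n : ℤ, (-1 : ℂ) ^ n * qParam τ ^ (n ^ 2) * Complex.exp (2 * n * Complex.I * z)

/-- `ϑ₄^{(k)}(0)`, the derivative being taken with respect to `z`. -/
def theta4Deriv (τ : ℂ) (k : ℕ) : ℂ := iteratedDeriv k (theta4 τ) 0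

/-- `Φ_s(q) = ∑_{n ≥ 1} n^s q^n / (1 - q^n)`. -/
def Phi (s : ℕ) (q : ℂ) : ℂ :=
  ∑' n : ℕ+, ((n : ℕ) : ℂ) ^ s * q ^ (n : ℕ) / (1 - q ^ (n : ℕ))

/-- `E_k(τ) = 1 - (2k / B_k) Φ_{k-1}(e^{2πiτ})`, used for even `k ≥ 2`; for `k = 2` this is the
holomorphic series `P(e^{2πiτ}) = 1 - 24 Φ₁(e^{2πiτ})`. -/
def eisensteinE (k : ℕ) (τ : ℂ) : ℂ :=
  1 - 2 * (k : ℂ) / ((bernoulli k : ℚ) : ℂ) * Phi (k - 1) (qParam τ)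

/-- Ramanujan's `P`. -/
def ramP (q : ℂ) : ℂ := 1 - 24 * Phi 1 q

/-- Ramanujan's `Q`. -/
def ramQ (q : ℂ) : ℂ := 1 + 240 * Phi 3 q

/-- Ramanujan's `R`. -/
def ramR (q : ℂ) : ℂ := 1 - 504 * Phi 5 q

/-- The tuples `(m₁, …, mₙ)` of natural numbers with `1·m₁ + 2·m₂ + ⋯ + n·mₙ = n`; the entry `m_j`
is `m (j - 1)`, since the index type `Fin n` starts at `0`. -/
def faaTuples (n : ℕ) : Finset (Fin n → ℕ) :=
  (Fintype.piFinset fun _ : Fin n => Finset.range (n + 1)).filter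
    fun m => ∑ j : Fin n, ((j : ℕ) + 1) * m j = n

theorem mem_faaTuples {n : ℕ} {m : Fin n → ℕ} :
    m ∈ faaTuples n ↔ ∑ j : Fin n, ((j : ℕ) + 1) * m j = n := by
  simp only [faaTuples, Finset.mem_filter, Fintype.mem_piFinset, Finset.mem_range,
    and_iff_right_iff_imp]
  intro h i
  have h1 : ((i : ℕ) + 1) * m i ≤ ∑ j : Fin n, ((j : ℕ) + 1) * m j :=
    Finset.single_le_sum (f := fun j : Fin n => ((j : ℕ) + 1) * m j)
      (fun _ _ => Nat.zero_le _) (Finset.mem_univ i)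
  nlinarith [Nat.zero_le ((i : ℕ) * m i)]

/-- `n! / (m₁! (1!)^{m₁} m₂! (2!)^{m₂} ⋯ mₙ! (n!)^{mₙ})`. -/
def faaCoeff {n : ℕ} (m : Fin n → ℕ) : ℂ :=
  (n.factorial : ℂ) /
    ∏ j : Fin n, (((m j).factorial : ℂ) * ((((j : ℕ) + 1).factorial : ℂ)) ^ m j)

/-- With `M = m₁ + ⋯ + mₙ`, the product of `n! / (m₁! (1!)^{m₁} ⋯ mₙ! (n!)^{mₙ})`,
`(-1)^M Γ(M) / ϑ₄(0)^M` and `∏_{j=1}^n (ϑ₄^{(j)}(0))^{m_j}`. -/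
def faaTerm (τ : ℂ) {n : ℕ} (m : Fin n → ℕ) : ℂ :=
  faaCoeff m
    * ((-1) ^ (∑ j, m j) * Complex.Gamma ((∑ j, m j : ℕ) : ℂ) / theta4 τ 0 ^ (∑ j, m j))
    * ∏ j : Fin n, theta4Deriv τ ((j : ℕ) + 1) ^ m j

/-- `θ₂(0 | t) = ∑_{n ∈ ℤ} e^{πit(n+1/2)²}`. -/
def theta2Const (t : ℂ) : ℂ :=
  ∑' n : ℤ, Complex.exp (Real.pi * Complex.I * t * ((n : ℂ) + 1 / 2) ^ 2)

/-- `θ₃(0 | t) = ∑_{n ∈ ℤ} e^{πitn²}`. -/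
def theta3Const (t : ℂ) : ℂ :=
  ∑' n : ℤ, Complex.exp (Real.pi * Complex.I * t * (n : ℂ) ^ 2)

/-- The elliptic modulus `θ₂² / θ₃²` as a function of `t` in the upper half-plane, the nome
being `e^{πit}`. -/
def modulus (t : ℂ) : ℂ := theta2Const t ^ 2 / theta3Const t ^ 2

/-- The quarter period `(π/2) θ₃²` as a function of `t` in the upper half-plane, the nome being
`e^{πit}`. -/
def quarterPeriod (t : ℂ) : ℂ := Real.pi / 2 * theta3Const t ^ 2

/-- The complete elliptic integral of the first kind of modulus `x`. -/
def ellipticK (x : ℝ) : ℝ :=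
  ∫ φ in (0 : ℝ)..(Real.pi / 2), 1 / Real.sqrt (1 - x ^ 2 * Real.sin φ ^ 2)

/-- `x` is the elliptic modulus that belongs to the real nome `p`: `0 < x < 1` and
`p = exp (-π K(√(1 - x²)) / K(x))`. -/
def IsModulusOfNome (x p : ℝ) : Prop :=
  0 < x ∧ x < 1 ∧
    p = Real.exp (-Real.pi * ellipticK (Real.sqrt (1 - x ^ 2)) / ellipticK x)

/-- The polynomial with coefficients `c` and all exponents at most `d`, evaluated at `P, Q, R` at
`q` and `P, Q, R` at `q²`. -/
def evalPQR (d : ℕ) (c : ℕ → ℕ → ℕ → ℕ → ℕ → ℕ → ℚ) (q : ℂ) : ℂ :=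
  ∑ i ∈ Finset.range (d + 1), ∑ j ∈ Finset.range (d + 1), ∑ k ∈ Finset.range (d + 1),
    ∑ l ∈ Finset.range (d + 1), ∑ m ∈ Finset.range (d + 1), ∑ n ∈ Finset.range (d + 1),
      ((c i j k l m n : ℚ) : ℂ) * ramP q ^ i * ramQ q ^ j * ramR q ^ k
        * ramP (q ^ 2) ^ l * ramQ (q ^ 2) ^ m * ramR (q ^ 2) ^ n

end

end ThetaDeriv

open ThetaDeriv

/-!
The idea is that `log ϑ₄` has a Fourier series whose derivatives at `0` are Lambert series.

By Jacobi's triple product (`theta4_eq_exp_qLog`), near `z = 0`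
`log ϑ₄(z) = const - ∑_{m ≥ 1} q^m (e^{2miz} + e^{-2miz}) / (m (1 - q^{2m}))`.
The derivatives of this series at `0` vanish in odd order, and the one of order `2ν` is a constant
times `Φ_{2ν-1}(q) - Φ_{2ν-1}(q²)`, a difference of Eisenstein series (`logTheta_even`). In
particular `ϑ₄(0) ≠ 0`. The sum over tuples in the theorem is Faà di Bruno's formula for
`-(log ϑ₄)^{(2ν)}(0)`, which is obtained from the logarithm of a formal power series
(`sum_faaTuples_log`). Isolating the tuple `(0, …, 0, 1)` gives the recurrence.

For the polynomial evaluation, Leibniz's rule for `ϑ₄' = (log ϑ₄)' ϑ₄` writes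
`ϑ₄^{(2ν)}(0) / ϑ₄(0)` as a rational polynomial in the Eisenstein series of weight at most `2ν` at
`τ` and `2τ`. Every Eisenstein series of even weight at least `4` is a rational polynomial in
`E₄ = Q` and `E₆ = R`; this holds for all level one modular forms with rational `q`-expansion, by
induction on the weight and division by the discriminant (`isPolyIn_E₄_E₆`). All degrees stay at most `ν`.

The formula `ϑ₄(0)² = (2/π)(1 - x) K` is the duplication `θ₄(t)² = θ₃(2t)² - θ₂(2t)²`, obtained by
rearranging a double series. On the imaginary axis the duplication formulas say that `t ↦ 2t` acts
on `(θ₃², θ₄²)` as a step of the arithmetic-geometric mean. Gauss's integral is invariant under such a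
step (`gaussIntegral_agm`), and `(θ₃², θ₄²)` tends to `(1, 1)`, so that
`∫_0^{π/2} dφ / √(θ₃⁴ cos² φ + θ₄⁴ sin² φ) = π/2` (`gaussIntegral_theta`), which is
`K(x) = (π/2) θ₃²`. Jacobi's imaginary transformation gives the complementary integral, hence the
nome of `x`; that no other modulus has this nome follows from the monotonicity of `K`.
-/

namespace ThetaDeriv

open Filter Topology Finset

/-! ### The Jacobi triple product -/

/-- The finite `q`-Pochhammer symbol `(u; Q)_N = ∏_{k < N} (1 - u Q^k)`. -/
noncomputable def qPoch (u Q : ℂ) (N : ℕ) : ℂ := ∏ k ∈ range N, (1 - u * Q ^ k)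

/-- The series `∑_{m ≥ 1} u^m / (m (1 - Q^m))`, which is `-log (u; Q)_∞`. The sum runs over all
natural numbers, and the term with `m = 0` vanishes because it is a division by zero. -/
noncomputable def qLog (u Q : ℂ) : ℂ := ∑' m : ℕ, u ^ m / (m * (1 - Q ^ m))

lemma one_sub_pow_ne_zero {Q : ℂ} (hQ : ‖Q‖ < 1) {m : ℕ} (hm : m ≠ 0) : 1 - Q ^ m ≠ 0 := by
  intro h
  have h1 : ‖Q ^ m‖ = 1 := by rw [← sub_eq_zero.mp h, norm_one]
  rw [norm_pow] at h1
  exact (pow_lt_one₀ (norm_nonneg _) hQ hm).ne h1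

lemma one_sub_norm_le_norm_one_sub_pow {Q : ℂ} (hQ : ‖Q‖ < 1) {m : ℕ} (hm : m ≠ 0) :
    1 - ‖Q‖ ≤ ‖1 - Q ^ m‖ := by
  calc 1 - ‖Q‖ ≤ 1 - ‖Q‖ ^ m := by
        have := pow_le_of_le_one (norm_nonneg Q) hQ.le hm
        linarith
    _ = ‖(1 : ℂ)‖ - ‖Q ^ m‖ := by rw [norm_one, norm_pow]
    _ ≤ _ := norm_sub_norm_le _ _

lemma norm_div_mul_one_sub_pow_le {Q : ℂ} (hQ : ‖Q‖ < 1) (c : ℂ) (m : ℕ) :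
    ‖c / (m * (1 - Q ^ m))‖ ≤ ‖c‖ * (1 - ‖Q‖)⁻¹ := by
  have h0 : 0 < 1 - ‖Q‖ := by linarith
  rcases eq_or_ne m 0 with rfl | hm
  · simp only [pow_zero, sub_self, mul_zero, div_zero, norm_zero]
    positivity
  · rw [norm_div, div_eq_mul_inv]
    gcongr
    rw [norm_mul, Complex.norm_natCast]
    have h1 : (1 : ℝ) ≤ m := by exact_mod_cast Nat.one_le_iff_ne_zero.mpr hm
    calc 1 - ‖Q‖ ≤ ‖1 - Q ^ m‖ := one_sub_norm_le_norm_one_sub_pow hQ hm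
      _ ≤ m * ‖1 - Q ^ m‖ := le_mul_of_one_le_left (norm_nonneg _) h1

lemma qPoch_eq_exp {u Q : ℂ} (hu : ‖u‖ < 1) (hQ : ‖Q‖ < 1) (N : ℕ) :
    qPoch u Q N = Complex.exp (-∑' m : ℕ, u ^ m * (1 - Q ^ (m * N)) / (m * (1 - Q ^ m))) := by
  have hk : ∀ k : ℕ, ‖u * Q ^ k‖ < 1 := fun k => by
    rw [norm_mul, norm_pow]
    exact mul_lt_one_of_nonneg_of_lt_one_left (norm_nonneg _) hu
      (pow_le_one₀ (norm_nonneg _) hQ.le)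
  have hs : HasSum (fun m : ℕ => ∑ k ∈ range N, (u * Q ^ k) ^ m / m)
      (∑ k ∈ range N, -Complex.log (1 - u * Q ^ k)) :=
    hasSum_sum fun k _ => Complex.hasSum_taylorSeries_neg_log (hk k)
  have he : (fun m : ℕ => ∑ k ∈ range N, (u * Q ^ k) ^ m / m)
      = fun m : ℕ => u ^ m * (1 - Q ^ (m * N)) / (m * (1 - Q ^ m)) := by
    funext m
    rcases eq_or_ne m 0 with rfl | hm
    · simp
    · have h1 := one_sub_pow_ne_zero hQ hm
      have h2 : ∑ k ∈ range N, (Q ^ m) ^ k = (1 - Q ^ (m * N)) / (1 - Q ^ m) := by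
        rw [eq_div_iff h1, pow_mul, geom_sum_mul_neg (Q ^ m)]
      have h3 : ∀ k ∈ range N, (u * Q ^ k) ^ m / m = u ^ m / m * (Q ^ m) ^ k := fun k _ => by
        rw [mul_pow, ← pow_mul, ← pow_mul, mul_comm k m]; ring
      rw [sum_congr rfl h3, ← mul_sum, h2]
      field_simp
  rw [← he, hs.tsum_eq, sum_neg_distrib, neg_neg, Complex.exp_sum, qPoch]
  refine prod_congr rfl fun k _ => (Complex.exp_log fun h => ?_).symm
  have h1 := hk k
  rw [← sub_eq_zero.mp h, norm_one] at h1
  exact lt_irrefl _ h1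

lemma tendsto_qPoch {u Q : ℂ} (hu : ‖u‖ < 1) (hQ : ‖Q‖ < 1) :
    Tendsto (qPoch u Q) atTop (𝓝 (Complex.exp (-qLog u Q))) := by
  have h : Tendsto (fun N : ℕ => ∑' m : ℕ, u ^ m * (1 - Q ^ (m * N)) / (m * (1 - Q ^ m)))
      atTop (𝓝 (qLog u Q)) := by
    refine tendsto_tsum_of_dominated_convergence
      (bound := fun m : ℕ => ‖u‖ ^ m * 2 * (1 - ‖Q‖)⁻¹) ?_ ?_ ?_
    · exact ((summable_geometric_of_lt_one (norm_nonneg _) hu).mul_right _).mul_right _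
    · intro m
      rcases eq_or_ne m 0 with rfl | hm
      · simp
      · have h1 : Tendsto (fun N : ℕ => Q ^ (m * N)) atTop (𝓝 0) := by
          simp_rw [pow_mul]
          refine tendsto_pow_atTop_nhds_zero_of_norm_lt_one ?_
          rw [norm_pow]
          exact pow_lt_one₀ (norm_nonneg _) hQ hm
        have h2 := ((h1.const_sub 1).const_mul (u ^ m)).div_const (m * (1 - Q ^ m))
        simpa using h2
    · refine Eventually.of_forall fun N m => (norm_div_mul_one_sub_pow_le hQ _ m).trans ?_
      have h0 : 0 < 1 - ‖Q‖ := by linarith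
      gcongr
      rw [norm_mul, norm_pow]
      gcongr
      calc ‖1 - Q ^ (m * N)‖ ≤ ‖(1 : ℂ)‖ + ‖Q ^ (m * N)‖ := norm_sub_le _ _
        _ ≤ 1 + 1 := by
          rw [norm_one, norm_pow]
          gcongr
          exact pow_le_one₀ (norm_nonneg _) hQ.le
        _ = 2 := by norm_num
  refine ((Complex.continuous_exp.tendsto _).comp h.neg).congr fun N => ?_
  rw [qPoch_eq_exp hu hQ]; rfl

lemma qPoch_ne_zero {u Q : ℂ} (hu : ‖u‖ < 1) (hQ : ‖Q‖ < 1) (N : ℕ) : qPoch u Q N ≠ 0 := by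
  rw [qPoch_eq_exp hu hQ]; exact Complex.exp_ne_zero _

/-- The Gaussian binomial coefficient `[m choose j]_Q`, by its Pascal recursion. -/
def gaussBinom (Q : ℂ) : ℕ → ℕ → ℂ
  | _, 0 => 1
  | 0, _ + 1 => 0
  | m + 1, j + 1 => Q ^ (j + 1) * gaussBinom Q m (j + 1) + gaussBinom Q m j

lemma gaussBinom_zero_right (Q : ℂ) (m : ℕ) : gaussBinom Q m 0 = 1 := by
  cases m <;> rfl

lemma gaussBinom_eq_zero (Q : ℂ) : ∀ {m j : ℕ}, m < j → gaussBinom Q m j = 0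
  | 0, _ + 1, _ => rfl
  | m + 1, j + 1, h => by
    rw [gaussBinom, gaussBinom_eq_zero Q (by omega : m < j + 1),
      gaussBinom_eq_zero Q (by omega : m < j), mul_zero, add_zero]

lemma qPoch_self_succ (Q : ℂ) (n : ℕ) : qPoch Q Q (n + 1) = qPoch Q Q n * (1 - Q ^ (n + 1)) := by
  rw [qPoch, prod_range_succ, ← qPoch, pow_succ' Q n]

lemma gaussBinom_mul (Q : ℂ) (j k : ℕ) :
    gaussBinom Q (j + k) j * (qPoch Q Q j * qPoch Q Q k) = qPoch Q Q (j + k) := by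
  induction hn : j + k generalizing j k with
  | zero =>
    obtain ⟨rfl, rfl⟩ : j = 0 ∧ k = 0 := by omega
    simp [gaussBinom, qPoch]
  | succ n ih =>
    rcases j with _ | j
    · obtain rfl : k = n + 1 := by omega
      simp [gaussBinom_zero_right, qPoch]
    · rcases k with _ | k
      · obtain rfl : j = n := by omega
        have h := ih j 0 (by omega)
        rw [gaussBinom, gaussBinom_eq_zero Q (by omega), qPoch_self_succ]
        linear_combination (1 - Q ^ (j + 1)) * h
      · have h1 := ih j (k + 1) (by omega)
        have h2 := ih (j + 1) k (by omega)
        have h3 : Q ^ (n + 1) = Q ^ (j + 1) * Q ^ (k + 1) := by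
          rw [← pow_add]; congr 1; omega
        rw [gaussBinom, qPoch_self_succ Q n, h3]
        rw [qPoch_self_succ Q k] at h1 ⊢
        rw [qPoch_self_succ Q j] at h2 ⊢
        linear_combination Q ^ (j + 1) * (1 - Q ^ (k + 1)) * h2 + (1 - Q ^ (j + 1)) * h1

/-- Rothe's `q`-binomial theorem. -/
lemma prod_one_add_mul_pow (Q x : ℂ) (m : ℕ) :
    ∏ k ∈ range m, (1 + x * Q ^ k)
      = ∑ j ∈ range (m + 1), gaussBinom Q m j * Q ^ (j.choose 2) * x ^ j := by
  induction m generalizing x with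
  | zero => simp [gaussBinom]
  | succ m ih =>
    have h1 : ∏ k ∈ range m, (1 + x * Q ^ (k + 1)) = ∏ k ∈ range m, (1 + x * Q * Q ^ k) :=
      prod_congr rfl fun k _ => by ring
    rw [prod_range_succ', h1, ih, sum_range_succ' _ (m + 1)]
    simp only [gaussBinom, pow_zero, mul_one, Nat.choose_zero_succ]
    have h2 : ∑ j ∈ range (m + 1), (Q ^ (j + 1) * gaussBinom Q m (j + 1) + gaussBinom Q m j)
          * Q ^ ((j + 1).choose 2) * x ^ (j + 1)
        = (∑ j ∈ range (m + 1), gaussBinom Q m (j + 1) * Q ^ ((j + 1).choose 2)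
            * (x * Q) ^ (j + 1))
          + x * ∑ j ∈ range (m + 1), gaussBinom Q m j * Q ^ (j.choose 2) * (x * Q) ^ j := by
      rw [mul_sum, ← sum_add_distrib]
      refine sum_congr rfl fun j _ => ?_
      have h3 : (j + 1).choose 2 = j + j.choose 2 := by
        rw [Nat.choose_succ_succ' j 1, Nat.choose_one_right]
      rw [h3, mul_pow, mul_pow, pow_add Q j]
      ring
    have h4 := sum_range_succ' (fun j => gaussBinom Q m j * Q ^ (j.choose 2) * (x * Q) ^ j) (m + 1)
    rw [sum_range_succ, gaussBinom_eq_zero Q (Nat.lt_succ_self m)] at h4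
    simp only [gaussBinom_zero_right, pow_zero, mul_one, Nat.choose_zero_succ, zero_mul,
      add_zero] at h4
    rw [h2]
    linear_combination h4

/-- The finite form of the triple product identity. -/
lemma finite_triple_product {q w : ℂ} (hq : q ≠ 0) (hw : w ≠ 0) (N : ℕ) :
    qPoch (q * w) (q ^ 2) N * qPoch (q * w⁻¹) (q ^ 2) N
      = ∑ j ∈ range (2 * N + 1), gaussBinom (q ^ 2) (2 * N) j
          * ((-1) ^ ((j : ℤ) - N) * q ^ (((j : ℤ) - N) ^ 2) * w ^ ((j : ℤ) - N)) := by
  -- For this `x` the last `N` of the `2N` factors in Rothe's theorem are `1 - w q^{2k+1}`, and the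
  -- first `N`, in reverse order, are `1 - w⁻¹ q^{2k+1}` up to the factors `-w q^{-(2k+1)}`.
  set x : ℂ := -w * q ^ (1 - 2 * (N : ℤ)) with hx
  have hR := prod_one_add_mul_pow (q ^ 2) x (2 * N)
  have hA : ∏ k ∈ range N, (1 + x * (q ^ 2) ^ (N + k)) = qPoch (q * w) (q ^ 2) N := by
    refine prod_congr rfl fun k _ => ?_
    have : x * (q ^ 2) ^ (N + k) = -(q * w * (q ^ 2) ^ k) := by
      rw [hx, ← pow_mul, ← pow_mul, ← zpow_natCast q (2 * (N + k)), mul_assoc, ← zpow_add₀ hq,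
        show 1 - 2 * (N : ℤ) + ((2 * (N + k) : ℕ) : ℤ) = ((2 * k + 1 : ℕ) : ℤ) by push_cast; ring,
        zpow_natCast]
      ring
    rw [this]; ring
  have hB : ∏ k ∈ range N, (1 + x * (q ^ 2) ^ k)
      = (-w) ^ N * q ^ (-(N : ℤ) ^ 2) * qPoch (q * w⁻¹) (q ^ 2) N := by
    rw [← prod_range_reflect]
    have h1 : ∀ k ∈ range N, 1 + x * (q ^ 2) ^ (N - 1 - k)
        = (-w) * (q ^ (2 * k + 1))⁻¹ * (1 - q * w⁻¹ * (q ^ 2) ^ k) := fun k hk => by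
      have hk' : k + 1 ≤ N := mem_range.mp hk
      have : x * (q ^ 2) ^ (N - 1 - k) = -w * (q ^ (2 * k + 1))⁻¹ := by
        rw [hx, ← pow_mul, ← zpow_natCast q (2 * (N - 1 - k)), mul_assoc, ← zpow_add₀ hq,
          show 1 - 2 * (N : ℤ) + ((2 * (N - 1 - k) : ℕ) : ℤ) = -((2 * k + 1 : ℕ) : ℤ) by omega,
          zpow_neg, zpow_natCast]
      rw [this]
      field_simp
      ring
    rw [prod_congr rfl h1, prod_mul_distrib, prod_mul_distrib, prod_const, card_range, ← qPoch]
    congr 2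
    rw [prod_inv_distrib, prod_pow_eq_pow_sum, sum_add_distrib, ← mul_sum, zpow_neg,
      ← zpow_natCast]
    congr 2
    have h2 := Finset.sum_range_id_mul_two N
    have h3 : (2 * ∑ i ∈ range N, i + ∑ i ∈ range N, 1) = N ^ 2 := by
      rw [sum_const, card_range, smul_eq_mul, mul_one, mul_comm 2, h2]
      rcases N with _ | N
      · rfl
      · rw [Nat.add_sub_cancel]; ring
    rw [h3]; push_cast; ring
  rw [two_mul N, prod_range_add, hA, hB, ← two_mul N] at hR
  have hC : (-w) ^ N * q ^ (-(N : ℤ) ^ 2) ≠ 0 :=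
    mul_ne_zero (pow_ne_zero _ (neg_ne_zero.mpr hw)) (zpow_ne_zero _ hq)
  refine mul_left_cancel₀ hC ?_
  rw [show (-w) ^ N * q ^ (-(N : ℤ) ^ 2) * (qPoch (q * w) (q ^ 2) N * qPoch (q * w⁻¹) (q ^ 2) N)
    = (-w) ^ N * q ^ (-(N : ℤ) ^ 2) * qPoch (q * w⁻¹) (q ^ 2) N * qPoch (q * w) (q ^ 2) N by ring,
    hR, mul_sum]
  refine sum_congr rfl fun j _ => ?_
  have h5 : (q ^ 2) ^ (j.choose 2) * q ^ ((1 - 2 * (N : ℤ)) * j)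
      = q ^ (-(N : ℤ) ^ 2) * q ^ (((j : ℤ) - N) ^ 2) := by
    rw [← pow_mul, ← zpow_natCast, ← zpow_add₀ hq, ← zpow_add₀ hq]
    congr 1
    have h6 : ((2 * j.choose 2 : ℕ) : ℤ) = (j : ℤ) * (j - 1) := by
      rw [Nat.choose_two_right, Nat.mul_div_cancel' (Nat.even_mul_pred_self j).two_dvd]
      rcases j with _ | j
      · simp
      · push_cast; simp
    rw [h6]; ring
  have h7 : (-w) ^ j = (-w) ^ N * ((-1) ^ ((j : ℤ) - N) * w ^ ((j : ℤ) - N)) := by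
    rw [← mul_zpow, neg_one_mul, ← zpow_natCast, ← zpow_natCast,
      ← zpow_add₀ (neg_ne_zero.mpr hw)]
    congr 1; ring
  rw [hx, mul_pow, ← zpow_natCast (q ^ (1 - 2 * (N : ℤ))) j, ← zpow_mul, h7]
  linear_combination gaussBinom (q ^ 2) (2 * N) j
    * ((-w) ^ N * ((-1) ^ ((j : ℤ) - N) * w ^ ((j : ℤ) - N))) * h5

lemma qParam_ne_zero (τ : ℂ) : qParam τ ≠ 0 := Complex.exp_ne_zero _

lemma norm_qParam_lt_one {τ : ℂ} (hτ : 0 < τ.im) : ‖qParam τ‖ < 1 := by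
  rw [qParam, Complex.norm_exp, Real.exp_lt_one_iff]
  have : (2 * (Real.pi : ℂ) * Complex.I * τ).re = -(2 * Real.pi * τ.im) := by
    simp [Complex.mul_re, Complex.mul_im]
  rw [this, neg_lt_zero]
  have := Real.pi_pos
  positivity

lemma theta4_term_eq (τ z : ℂ) (n : ℤ) :
    (-1 : ℂ) ^ n * qParam τ ^ (n ^ 2) * Complex.exp (2 * n * Complex.I * z)
      = jacobiTheta₂_term n (1 / 2 + z / Real.pi) (2 * τ) := by
  have hpi : (Real.pi : ℂ) ≠ 0 := Complex.ofReal_ne_zero.mpr Real.pi_ne_zero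
  rw [jacobiTheta₂_term, qParam, ← Complex.exp_int_mul, ← Complex.exp_pi_mul_I,
    ← Complex.exp_int_mul, ← Complex.exp_add, ← Complex.exp_add]
  congr 1
  push_cast
  field_simp
  ring

lemma theta4_eq_jacobiTheta₂ (τ z : ℂ) :
    theta4 τ z = jacobiTheta₂ (1 / 2 + z / Real.pi) (2 * τ) :=
  tsum_congr (theta4_term_eq τ z)

lemma im_two_mul_pos {τ : ℂ} (hτ : 0 < τ.im) : 0 < (2 * τ).im := by
  rw [Complex.mul_im]; simp [hτ]

lemma summable_theta4_term {τ : ℂ} (hτ : 0 < τ.im) (z : ℂ) :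
    Summable fun n : ℤ =>
      (-1 : ℂ) ^ n * qParam τ ^ (n ^ 2) * Complex.exp (2 * n * Complex.I * z) := by
  simp_rw [theta4_term_eq]
  exact (summable_jacobiTheta₂_term_iff _ _).mpr (im_two_mul_pos hτ)

/-- The Jacobi triple product for `ϑ₄`, with the infinite products written as exponentials of
their logarithms. It is the limit of `finite_triple_product`, by dominated convergence. -/
theorem theta4_eq_exp_qLog {τ z : ℂ} (hτ : 0 < τ.im)
    (h1 : ‖qParam τ * Complex.exp (2 * Complex.I * z)‖ < 1)
    (h2 : ‖qParam τ * (Complex.exp (2 * Complex.I * z))⁻¹‖ < 1) :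
    theta4 τ z = Complex.exp (-qLog (qParam τ ^ 2) (qParam τ ^ 2))
      * Complex.exp (-(qLog (qParam τ * Complex.exp (2 * Complex.I * z)) (qParam τ ^ 2)
          + qLog (qParam τ * (Complex.exp (2 * Complex.I * z))⁻¹) (qParam τ ^ 2))) := by
  set q := qParam τ
  set w := Complex.exp (2 * Complex.I * z) with hw
  set Q := q ^ 2
  set c := Complex.exp (-qLog Q Q)
  have hq : q ≠ 0 := qParam_ne_zero τ
  have hw0 : w ≠ 0 := Complex.exp_ne_zero _
  have hQ : ‖Q‖ < 1 := by
    rw [norm_pow]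
    exact pow_lt_one₀ (norm_nonneg _) (norm_qParam_lt_one hτ) two_ne_zero
  have hc0 : c ≠ 0 := Complex.exp_ne_zero _
  have hP := tendsto_qPoch hQ hQ
  have hP0 := qPoch_ne_zero hQ hQ
  -- The Gaussian binomials are bounded uniformly, because `(Q; Q)_n` and its inverse converge.
  obtain ⟨B, hB⟩ := (Metric.isBounded_range_of_tendsto _ hP).exists_norm_le
  obtain ⟨B', hB'⟩ := (Metric.isBounded_range_of_tendsto _ (hP.inv₀ hc0)).exists_norm_le
  replace hB : ∀ n, ‖qPoch Q Q n‖ ≤ B := fun n => hB _ ⟨n, rfl⟩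
  replace hB' : ∀ n, ‖(qPoch Q Q n)⁻¹‖ ≤ B' := fun n => hB' _ ⟨n, rfl⟩
  have hB0 : 0 ≤ B := (norm_nonneg _).trans (hB 0)
  have hB0' : 0 ≤ B' := (norm_nonneg _).trans (hB' 0)
  have hg : ∀ j k, gaussBinom Q (j + k) j
      = qPoch Q Q (j + k) * (qPoch Q Q j)⁻¹ * (qPoch Q Q k)⁻¹ := fun j k => by
    rw [← gaussBinom_mul Q j k]
    have := hP0 j
    have := hP0 k
    field_simp
  let t : ℤ → ℂ := fun n => (-1 : ℂ) ^ n * q ^ (n ^ 2) * w ^ n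
  have ht : ∀ n : ℤ, t n = (-1 : ℂ) ^ n * q ^ (n ^ 2) * Complex.exp (2 * n * Complex.I * z) :=
    fun n => by
      simp only [t, hw]
      rw [← Complex.exp_int_mul]
      congr 2; ring
  have hts : Summable t := by
    rw [show t = _ from funext ht]; exact summable_theta4_term hτ z
  let F : ℕ → ℤ → ℂ := fun N n =>
    if n ∈ Finset.Icc (-(N : ℤ)) N then gaussBinom Q (2 * N) (n + N).toNat * t n else 0
  have hF : ∀ N, ∑' n, F N n = qPoch (q * w) Q N * qPoch (q * w⁻¹) Q N := fun N => by
    rw [finite_triple_product hq hw0, tsum_eq_sum (s := Finset.Icc (-(N : ℤ)) N)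
      fun n hn => if_neg hn]
    refine (sum_nbij' (fun j : ℕ => (j : ℤ) - N) (fun n : ℤ => (n + N).toNat)
      ?_ ?_ ?_ ?_ ?_).symm
    · intro j hj; simp only [mem_range, mem_Icc] at hj ⊢; omega
    · intro j hj; simp only [mem_range, mem_Icc] at hj ⊢; omega
    · intro j hj; simp
    · intro j hj; simp only [mem_Icc] at hj; omega
    · intro j hj
      have : (j : ℤ) - N ∈ Finset.Icc (-(N : ℤ)) N := by
        simp only [mem_range, mem_Icc] at hj ⊢; omega
      simp only [if_pos this, t, sub_add_cancel, Int.toNat_natCast]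
      rfl
  have hlim : Tendsto (fun N => ∑' n, F N n) atTop (𝓝 (∑' n, c⁻¹ * t n)) := by
    refine tendsto_tsum_of_dominated_convergence (bound := fun n => B * B' * B' * ‖t n‖) ?_ ?_ ?_
    · exact hts.norm.mul_left _
    · intro n
      have hT : ∀ f : ℕ → ℕ, (∀ N, N ≤ f N + n.natAbs) → Tendsto f atTop atTop := fun f hf => by
        refine tendsto_atTop_mono (f := fun N => N - n.natAbs) (fun N => ?_)
          (tendsto_sub_atTop_nat _)
        have := hf N
        omega
      have a1 := hP.comp (hT (fun N => 2 * N) fun N => by omega)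
      have a2 := (hP.comp (hT (fun N : ℕ => (n + N).toNat) fun N => by omega)).inv₀ hc0
      have a3 := (hP.comp (hT (fun N : ℕ => (N - n).toNat) fun N => by omega)).inv₀ hc0
      have a4 := ((a1.mul a2).mul a3).mul_const (t n)
      have e5 : c * c⁻¹ * c⁻¹ * t n = c⁻¹ * t n := by rw [mul_inv_cancel₀ hc0, one_mul]
      rw [e5] at a4
      refine a4.congr' ?_
      filter_upwards [eventually_ge_atTop n.natAbs] with N hN
      have hm : n ∈ Finset.Icc (-(N : ℤ)) N := by rw [mem_Icc]; omega
      have e6 : 2 * N = (n + N).toNat + (N - n).toNat := by omega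
      simp only [F, if_pos hm, Function.comp_apply]
      rw [e6, hg]
    · refine Eventually.of_forall fun N n => ?_
      simp only [F]
      split_ifs with hm
      · rw [mem_Icc] at hm
        have e6 : 2 * N = (n + N).toNat + (N - n).toNat := by omega
        rw [e6, hg, norm_mul, norm_mul, norm_mul]
        gcongr
        exacts [hB _, hB' _, hB' _]
      · rw [norm_zero]; positivity
  have hlim2 := (tendsto_qPoch h1 hQ).mul (tendsto_qPoch h2 hQ)
  simp_rw [hF] at hlim
  have hE := tendsto_nhds_unique hlim hlim2
  rw [tsum_mul_left, ← Complex.exp_add] at hE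
  rw [neg_add, ← hE, ← mul_assoc, mul_inv_cancel₀ hc0, one_mul]
  exact tsum_congr fun n => (ht n).symm

/-! ### Faà di Bruno's formula for the logarithm -/

lemma coeff_prod_monomial_pow {n : ℕ} (c : Fin n → ℂ) (m : Fin n → ℕ) (d : ℕ) :
    PowerSeries.coeff d (∏ j : Fin n, (PowerSeries.monomial ((j : ℕ) + 1) (c j)) ^ m j)
      = if d = ∑ j : Fin n, ((j : ℕ) + 1) * m j then ∏ j, c j ^ m j else 0 := by
  have h : ∏ j : Fin n, (PowerSeries.monomial ((j : ℕ) + 1) (c j)) ^ m j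
      = PowerSeries.C (∏ j, c j ^ m j) * PowerSeries.X ^ (∑ j : Fin n, ((j : ℕ) + 1) * m j) := by
    rw [← prod_pow_eq_pow_sum, map_prod, ← prod_mul_distrib]
    refine prod_congr rfl fun j _ => ?_
    rw [PowerSeries.monomial_eq_C_mul_X_pow, mul_pow, map_pow, ← pow_mul]
  rw [h, PowerSeries.coeff_C_mul, PowerSeries.coeff_X_pow]
  simp

/-- The coefficient of `X^n` in a power of a power series without constant term, as a sum over the
tuples of Faà di Bruno's formula. -/
lemma coeff_pow_eq_sum_faaTuples {U : PowerSeries ℂ} (hU : PowerSeries.constantCoeff U = 0)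
    (n M : ℕ) :
    PowerSeries.coeff n (U ^ M) = ∑ m ∈ (faaTuples n).filter (fun m => ∑ j, m j = M),
      (Nat.multinomial univ m : ℂ) * ∏ j : Fin n, PowerSeries.coeff ((j : ℕ) + 1) U ^ m j := by
  set V : PowerSeries ℂ := ∑ j : Fin n,
    PowerSeries.monomial ((j : ℕ) + 1) (PowerSeries.coeff ((j : ℕ) + 1) U) with hV
  have hUV : PowerSeries.X ^ (n + 1) ∣ U - V := by
    rw [PowerSeries.X_pow_dvd_iff]
    intro d hd
    rw [map_sub, hV, map_sum, sub_eq_zero]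
    simp_rw [PowerSeries.coeff_monomial]
    rcases d with _ | d
    · simp [hU]
    · rw [sum_eq_single (⟨d, by omega⟩ : Fin n)]
      · simp
      · intro j _ hj
        refine if_neg fun h => hj (Fin.ext ?_)
        simpa using h.symm
      · simp
  have h1 : PowerSeries.coeff n (U ^ M) = PowerSeries.coeff n (V ^ M) := by
    have := (PowerSeries.X_pow_dvd_iff.mp (hUV.trans (sub_dvd_pow_sub_pow U V M))) n
      (Nat.lt_succ_self n)
    rwa [map_sub, sub_eq_zero] at this
  rw [h1, hV, sum_pow_eq_sum_piAntidiag, map_sum]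
  have h2 : ∀ k ∈ piAntidiag (univ : Finset (Fin n)) M,
      PowerSeries.coeff n ((Nat.multinomial univ k : PowerSeries ℂ)
        * ∏ j : Fin n, PowerSeries.monomial ((j : ℕ) + 1) (PowerSeries.coeff ((j : ℕ) + 1) U) ^ k j)
      = if k ∈ faaTuples n then (Nat.multinomial univ k : ℂ)
          * ∏ j : Fin n, PowerSeries.coeff ((j : ℕ) + 1) U ^ k j else 0 := by
    intro k _
    rw [← map_natCast (PowerSeries.C (R := ℂ)), PowerSeries.coeff_C_mul, coeff_prod_monomial_pow,
      mul_ite, mul_zero]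
    simp only [mem_faaTuples, eq_comm]
  rw [sum_congr rfl h2, ← sum_filter]
  refine sum_congr ?_ fun _ _ => rfl
  ext k
  simp [mem_piAntidiag, and_comm]

/-- Faà di Bruno's formula for `log f`, as a statement about Taylor coefficients: `l k` plays the
role of the `k`-th derivative of `log f`, and the hypothesis is Leibniz's rule for
`f' = (log f)' f`. With `U = f / f(0) - 1`, both sides are read off from
`log (1 + U) = ∑ (-1)^M U^(M+1) / (M+1)`. -/
theorem sum_faaTuples_log {f l : ℕ → ℂ} (hf : f 0 ≠ 0)
    (h : ∀ n, f (n + 1) = ∑ i ∈ range (n + 1), (n.choose i : ℂ) * l (i + 1) * f (n - i))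
    {n : ℕ} (hn : n ≠ 0) :
    ∑ m ∈ faaTuples n, faaCoeff m
      * ((-1) ^ (∑ j, m j) * Complex.Gamma ((∑ j, m j : ℕ) : ℂ) / f 0 ^ (∑ j, m j))
      * ∏ j : Fin n, f ((j : ℕ) + 1) ^ m j = -l n := by
  have hfac : ∀ k : ℕ, (k.factorial : ℂ) ≠ 0 := fun k => by
    exact_mod_cast k.factorial_ne_zero
  set F : PowerSeries ℂ := PowerSeries.mk fun k => f k / k.factorial / f 0 with hF
  set D : PowerSeries ℂ := PowerSeries.mk fun k => l (k + 1) / k.factorial with hD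
  have hFD : PowerSeries.derivative ℂ F = D * F := by
    ext k
    rw [PowerSeries.coeff_derivative, PowerSeries.coeff_mul,
      Finset.Nat.sum_antidiagonal_eq_sum_range_succ
        (fun i j => PowerSeries.coeff i D * PowerSeries.coeff j F)]
    simp only [hF, hD, PowerSeries.coeff_mk]
    rw [h k, sum_div, sum_div, sum_mul]
    refine sum_congr rfl fun i hi => ?_
    have hik : i ≤ k := Nat.lt_succ_iff.mp (mem_range.mp hi)
    rw [Nat.cast_choose ℂ hik, Nat.factorial_succ]
    have := hfac k
    have := hfac i
    have := hfac (k - i)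
    have : (k : ℂ) + 1 ≠ 0 := by exact_mod_cast k.succ_ne_zero
    push_cast
    field_simp
  set U : PowerSeries ℂ := F - 1 with hUdef
  have hU0 : PowerSeries.constantCoeff U = 0 := by
    rw [hUdef, map_sub, hF, ← PowerSeries.coeff_zero_eq_constantCoeff_apply, PowerSeries.coeff_mk]
    simp [hf]
  have hUF : F = 1 + U := by rw [hUdef]; ring
  have hFne : F ≠ 0 := fun h0 => by
    have : PowerSeries.coeff 0 F = 0 := by rw [h0, map_zero]
    rw [hF, PowerSeries.coeff_mk] at this
    simp [hf] at this
  -- `G` is `log (1 + U)` cut off after `U ^ n`; since `X ∣ U`, this does not affect the coefficient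
  -- of `X ^ n`.
  set G : PowerSeries ℂ := ∑ M ∈ range n, ((-1) ^ M / ((M : ℂ) + 1)) • U ^ (M + 1) with hG
  have hdU : PowerSeries.derivative ℂ U = D * F := by
    rw [hUdef, map_sub, hFD, Derivation.map_one_eq_zero, sub_zero]
  have hdG : PowerSeries.derivative ℂ G = D * (1 - (-U) ^ n) := by
    have h1 : PowerSeries.derivative ℂ G = (D * F) * ∑ M ∈ range n, (-U) ^ M := by
      rw [hG, map_sum, mul_sum]
      refine sum_congr rfl fun M _ => ?_
      have hM : (M : ℂ) + 1 ≠ 0 := by exact_mod_cast M.succ_ne_zero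
      rw [Derivation.map_smul, Derivation.leibniz_pow, hdU, Nat.add_sub_cancel, smul_eq_mul,
        ← Nat.cast_smul_eq_nsmul ℂ, smul_smul, Nat.cast_succ, div_mul_cancel₀ _ hM, neg_pow U]
      rw [PowerSeries.smul_eq_C_mul, map_pow, map_neg, map_one]
      ring
    have h2 : F * ∑ M ∈ range n, (-U) ^ M = 1 - (-U) ^ n := by
      rw [hUF, show (1 + U) = 1 - (-U) by ring, mul_neg_geom_sum]
    rw [h1, mul_assoc, h2]
  have hcoeff : PowerSeries.coeff n G = l n / n.factorial := by
    obtain ⟨k, rfl⟩ := Nat.exists_eq_succ_of_ne_zero hn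
    have h1 : PowerSeries.coeff k (PowerSeries.derivative ℂ G) = PowerSeries.coeff k D := by
      have h2 : PowerSeries.X ^ (k + 1) ∣ D * (-U) ^ (k + 1) :=
        (pow_dvd_pow_of_dvd ((PowerSeries.X_dvd_iff.mpr hU0).neg_right) _).mul_left _
      rw [hdG, mul_sub, mul_one, map_sub, PowerSeries.X_pow_dvd_iff.mp h2 k (Nat.lt_succ_self k),
        sub_zero]
    rw [PowerSeries.coeff_derivative, hD,
      PowerSeries.coeff_mk] at h1
    have hk : (k : ℂ) + 1 ≠ 0 := by exact_mod_cast k.succ_ne_zero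
    have := hfac k
    rw [Nat.succ_eq_add_one, eq_div_iff (hfac (k + 1)), Nat.factorial_succ]
    rw [eq_div_iff this] at h1
    push_cast
    linear_combination h1
  have hmaps : ∀ m ∈ faaTuples n, (∑ j, m j) - 1 ∈ range n := fun m hm => by
    rw [mem_faaTuples] at hm
    rw [mem_range]
    have : ∑ j, m j ≤ ∑ j : Fin n, ((j : ℕ) + 1) * m j :=
      sum_le_sum fun j _ => Nat.le_mul_of_pos_left _ (Nat.succ_pos _)
    omega
  have hpos : ∀ m ∈ faaTuples n, ∑ j, m j ≠ 0 := fun m hm h0 => by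
    rw [mem_faaTuples] at hm
    rw [sum_eq_zero_iff] at h0
    rw [sum_eq_zero fun j hj => by rw [h0 j hj, mul_zero]] at hm
    exact hn hm.symm
  -- Group the tuples by `M = m₁ + ⋯ + mₙ`, which is positive; the groups are indexed by `M - 1`.
  rw [← sum_fiberwise_of_maps_to hmaps]
  have hfin : l n = n.factorial * PowerSeries.coeff n G := by
    rw [hcoeff, mul_div_cancel₀ _ (hfac n)]
  rw [hfin, hG, map_sum, mul_sum, ← sum_neg_distrib]
  refine sum_congr rfl fun M _ => ?_
  have hfilter : (faaTuples n).filter (fun m => (∑ j, m j) - 1 = M)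
      = (faaTuples n).filter (fun m => ∑ j, m j = M + 1) := by
    refine filter_congr fun m hm => ?_
    have := hpos m hm
    omega
  rw [PowerSeries.coeff_smul, coeff_pow_eq_sum_faaTuples hU0, hfilter, smul_eq_mul, mul_sum,
    mul_sum, ← sum_neg_distrib]
  refine sum_congr rfl fun m hm => ?_
  have hm' : ∑ j, m j = M + 1 := (mem_filter.mp hm).2
  have hcU : ∀ j : Fin n, PowerSeries.coeff ((j : ℕ) + 1) U
      = f ((j : ℕ) + 1) / ((j : ℕ) + 1).factorial / f 0 := fun j => by
    rw [hUdef, map_sub, hF, PowerSeries.coeff_mk, PowerSeries.coeff_one,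
      if_neg (Nat.succ_ne_zero _),
      sub_zero]
  have hmult : (∏ j, ((m j).factorial : ℂ)) * (Nat.multinomial univ m : ℂ)
      = ((M + 1).factorial : ℂ) := by
    rw [← hm']
    exact_mod_cast Nat.multinomial_spec univ m
  have hpf : ∏ j, ((m j).factorial : ℂ) ≠ 0 := prod_ne_zero_iff.mpr fun j _ => hfac _
  have hpf2 : ∏ j : Fin n, ((((j : ℕ) + 1).factorial : ℂ)) ^ m j ≠ 0 :=
    prod_ne_zero_iff.mpr fun j _ => pow_ne_zero _ (hfac _)
  simp_rw [hcU, div_pow, prod_div_distrib, prod_pow_eq_pow_sum, hm']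
  rw [faaCoeff, prod_mul_distrib, Nat.cast_succ, Complex.Gamma_nat_eq_factorial,
    eq_div_of_mul_eq hpf ((mul_comm _ _).trans hmult), Nat.factorial_succ]
  have hM : (M : ℂ) + 1 ≠ 0 := by exact_mod_cast M.succ_ne_zero
  push_cast
  field_simp
  ring

/-! ### The logarithm of `ϑ₄` and its derivatives -/

/-- The coefficient `q^m / (m (1 - q^{2m}))` of the Fourier series of `log ϑ₄`; it is `0` for
`m = 0`. -/
noncomputable def logCoeff (q : ℂ) (m : ℕ) : ℂ := q ^ m / (m * (1 - (q ^ 2) ^ m))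

/-- The `j`-th derivative in `z` of `-∑_{m ≥ 1} q^m (e^{2miz} + e^{-2miz}) / (m (1 - q^{2m}))`,
which is `log ϑ₄(z)` up to a constant, summed term by term. -/
noncomputable def logTheta (q : ℂ) (j : ℕ) (z : ℂ) : ℂ :=
  ∑' m : ℕ, -logCoeff q m
    * ((2 * m * Complex.I) ^ j * Complex.exp (2 * m * Complex.I * z)
      + (-(2 * m * Complex.I)) ^ j * Complex.exp (-(2 * m * Complex.I * z)))

/-- On the disc `‖z‖ ≤ δ` the terms of `logTheta` are dominated by a series that converges as long
as `‖q‖ e^{2δ} < 1`. -/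
lemma norm_logTheta_term_le {q : ℂ} (hq : ‖q‖ < 1) {δ : ℝ} (j m : ℕ) {z : ℂ}
    (hz : ‖z‖ ≤ δ) :
    ‖-logCoeff q m * ((2 * m * Complex.I) ^ j * Complex.exp (2 * m * Complex.I * z)
      + (-(2 * m * Complex.I)) ^ j * Complex.exp (-(2 * m * Complex.I * z)))‖
      ≤ (1 - ‖q ^ 2‖)⁻¹ * 2 * 2 ^ j * ((m : ℝ) ^ j * (‖q‖ * Real.exp (2 * δ)) ^ m) := by
  have hQ : ‖q ^ 2‖ < 1 := by
    rw [norm_pow]; exact pow_lt_one₀ (norm_nonneg _) hq two_ne_zero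
  have h1 : ‖(2 * m * Complex.I : ℂ)‖ = 2 * m := by simp
  have h2 : ‖2 * m * Complex.I * z‖ ≤ m * (2 * δ) := by
    rw [norm_mul, h1]
    nlinarith [mul_le_mul_of_nonneg_left hz (Nat.cast_nonneg (α := ℝ) m)]
  have h3 : ∀ w : ℂ, ‖w‖ ≤ m * (2 * δ) → ‖Complex.exp w‖ ≤ Real.exp (2 * δ) ^ m := fun w hw => by
    rw [← Real.exp_nat_mul]
    exact (Complex.norm_exp_le_exp_norm w).trans (Real.exp_le_exp.mpr hw)
  have h4 : ‖logCoeff q m‖ ≤ ‖q‖ ^ m * (1 - ‖q ^ 2‖)⁻¹ := by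
    rw [← norm_pow]
    exact norm_div_mul_one_sub_pow_le hQ _ m
  rw [norm_mul, norm_neg]
  calc _ ≤ (‖q‖ ^ m * (1 - ‖q ^ 2‖)⁻¹) * ((2 * m) ^ j * Real.exp (2 * δ) ^ m
          + (2 * m) ^ j * Real.exp (2 * δ) ^ m) := by
        gcongr
        refine (norm_add_le _ _).trans ?_
        rw [norm_mul, norm_mul, norm_pow, norm_pow, norm_neg, h1]
        gcongr
        · exact h3 _ h2
        · exact h3 _ (by rwa [norm_neg])
    _ = _ := by rw [mul_pow, mul_pow]; ring

lemma summable_pow_mul_pow {r : ℝ} (h0 : 0 ≤ r) (h1 : r < 1) (j : ℕ) :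
    Summable fun m : ℕ => (m : ℝ) ^ j * r ^ m :=
  summable_pow_mul_geometric_of_norm_lt_one j (by rwa [Real.norm_of_nonneg h0])

lemma hasDerivAt_logTheta {q : ℂ} (hq : ‖q‖ < 1) {δ : ℝ} (hδ : ‖q‖ * Real.exp (2 * δ) < 1)
    (j : ℕ) {z : ℂ} (hz : z ∈ Metric.ball (0 : ℂ) δ) :
    HasDerivAt (logTheta q j) (logTheta q (j + 1) z) z := by
  have h0 : 0 ≤ ‖q‖ * Real.exp (2 * δ) := by positivity
  have hb : ∀ y ∈ Metric.ball (0 : ℂ) δ, ‖y‖ ≤ δ := fun y hy => (mem_ball_zero_iff.mp hy).le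
  refine hasDerivAt_tsum_of_isPreconnected (t := Metric.ball (0 : ℂ) δ)
    ((summable_pow_mul_pow h0 hδ (j + 1)).mul_left _) Metric.isOpen_ball
    (convex_ball _ _).isPreconnected (fun m y _ => ?_)
    (fun m y hy => norm_logTheta_term_le hq (j + 1) m (hb y hy)) hz
    (Summable.of_norm_bounded ((summable_pow_mul_pow h0 hδ j).mul_left _)
      fun m => norm_logTheta_term_le hq j m (hb z hz)) hz
  have e1 : HasDerivAt (fun y : ℂ => 2 * m * Complex.I * y) (2 * m * Complex.I) y := by
    simpa using (hasDerivAt_id y).const_mul (2 * m * Complex.I)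
  have := (((e1.cexp).const_mul ((2 * m * Complex.I) ^ j)).add
    ((e1.fun_neg.cexp).const_mul ((-(2 * m * Complex.I)) ^ j))).const_mul (-logCoeff q m)
  refine this.congr_deriv ?_
  ring

lemma exists_radius {q : ℂ} (hq0 : q ≠ 0) (hq : ‖q‖ < 1) :
    ∃ δ : ℝ, 0 < δ ∧ ‖q‖ * Real.exp (2 * δ) < 1 := by
  have h0 : 0 < ‖q‖ := norm_pos_iff.mpr hq0
  refine ⟨-Real.log ‖q‖ / 4, by linarith [Real.log_neg h0 hq], ?_⟩
  nth_rewrite 1 [← Real.exp_log h0]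
  rw [← Real.exp_add, Real.exp_lt_one_iff]
  linarith [Real.log_neg h0 hq]

lemma iteratedDeriv_logTheta {q : ℂ} (hq : ‖q‖ < 1) {δ : ℝ} (hδ : ‖q‖ * Real.exp (2 * δ) < 1)
    (i j : ℕ) {z : ℂ} (hz : z ∈ Metric.ball (0 : ℂ) δ) :
    iteratedDeriv j (logTheta q i) z = logTheta q (i + j) z := by
  induction j generalizing z with
  | zero => simp
  | succ j ih =>
    rw [iteratedDeriv_succ]
    have h : iteratedDeriv j (logTheta q i) =ᶠ[𝓝 z] logTheta q (i + j) :=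
      Filter.eventuallyEq_of_mem (Metric.isOpen_ball.mem_nhds hz) fun y hy => ih hy
    rw [h.deriv_eq, (hasDerivAt_logTheta hq hδ (i + j) hz).deriv, add_assoc]

lemma theta4_eq_exp_logTheta {τ : ℂ} (hτ : 0 < τ.im) {δ : ℝ}
    (hδ : ‖qParam τ‖ * Real.exp (2 * δ) < 1) {z : ℂ} (hz : z ∈ Metric.ball (0 : ℂ) δ) :
    theta4 τ z = Complex.exp (-qLog (qParam τ ^ 2) (qParam τ ^ 2))
      * Complex.exp (logTheta (qParam τ) 0 z) := by
  have hz' : ‖z‖ ≤ δ := (mem_ball_zero_iff.mp hz).le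
  set q := qParam τ
  have hq1 : ‖q‖ < 1 := norm_qParam_lt_one hτ
  have hQ : ‖q ^ 2‖ < 1 := by
    rw [norm_pow]; exact pow_lt_one₀ (norm_nonneg _) hq1 two_ne_zero
  have hb : ∀ w : ℂ, ‖w‖ ≤ 2 * δ → ‖q * Complex.exp w‖ < 1 := fun w hw => by
    refine lt_of_le_of_lt ?_ hδ
    rw [norm_mul]
    gcongr
    exact (Complex.norm_exp_le_exp_norm w).trans (Real.exp_le_exp.mpr hw)
  have h1 : ‖2 * Complex.I * z‖ ≤ 2 * δ := by
    rw [norm_mul, norm_mul, Complex.norm_I, Complex.norm_ofNat]; linarith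
  have hb1 := hb _ h1
  have hb2 := hb (-(2 * Complex.I * z)) (by rwa [norm_neg])
  have hs : ∀ {u : ℂ}, ‖u‖ < 1 → Summable fun m : ℕ => u ^ m / (m * (1 - (q ^ 2) ^ m)) :=
    fun {u} hu => Summable.of_norm_bounded
      ((summable_geometric_of_lt_one (norm_nonneg u) hu).mul_right (1 - ‖q ^ 2‖)⁻¹) fun m => by
        rw [← norm_pow]; exact norm_div_mul_one_sub_pow_le hQ _ m
  rw [theta4_eq_exp_qLog hτ hb1 (by rwa [← Complex.exp_neg])]
  congr 2
  rw [← Complex.exp_neg, qLog, qLog, ← (hs hb1).tsum_add (hs hb2), ← tsum_neg, logTheta]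
  refine tsum_congr fun m => ?_
  rw [mul_pow, mul_pow, ← Complex.exp_nat_mul, ← Complex.exp_nat_mul, logCoeff,
    show (m : ℂ) * (2 * Complex.I * z) = 2 * m * Complex.I * z by ring,
    show (m : ℂ) * (-(2 * Complex.I * z)) = -(2 * m * Complex.I * z) by ring]
  ring

theorem theta4_zero_ne_zero {τ : ℂ} (hτ : 0 < τ.im) : theta4 τ 0 ≠ 0 := by
  obtain ⟨δ, h0, hδ⟩ := exists_radius (qParam_ne_zero τ) (norm_qParam_lt_one hτ)
  rw [theta4_eq_exp_logTheta hτ hδ (Metric.mem_ball_self h0)]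
  exact mul_ne_zero (Complex.exp_ne_zero _) (Complex.exp_ne_zero _)

/-- Leibniz's rule for `ϑ₄' = (log ϑ₄)' ϑ₄` at `z = 0`. -/
theorem theta4Deriv_succ {τ : ℂ} (hτ : 0 < τ.im) (n : ℕ) :
    theta4Deriv τ (n + 1) = ∑ i ∈ range (n + 1),
      (n.choose i : ℂ) * logTheta (qParam τ) (i + 1) 0 * theta4Deriv τ (n - i) := by
  have hq := norm_qParam_lt_one hτ
  obtain ⟨δ, h0, hδ⟩ := exists_radius (qParam_ne_zero τ) hq
  have hmem : Metric.ball (0 : ℂ) δ ∈ 𝓝 (0 : ℂ) := Metric.ball_mem_nhds 0 h0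
  have hder : ∀ z ∈ Metric.ball (0 : ℂ) δ,
      HasDerivAt (theta4 τ) (logTheta (qParam τ) 1 z * theta4 τ z) z := fun z hz => by
    have h1 := ((hasDerivAt_logTheta hq hδ 0 hz).cexp).const_mul
      (Complex.exp (-qLog (qParam τ ^ 2) (qParam τ ^ 2)))
    have h2 := h1.congr_of_eventuallyEq (Filter.eventuallyEq_of_mem
      (Metric.isOpen_ball.mem_nhds hz) fun y hy => theta4_eq_exp_logTheta hτ hδ hy)
    refine h2.congr_deriv ?_
    rw [theta4_eq_exp_logTheta hτ hδ hz]
    ring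
  have hc1 : ContDiffAt ℂ n (theta4 τ) 0 :=
    ((DifferentiableOn.analyticAt (fun z hz => (hder z hz).differentiableAt.differentiableWithinAt)
      hmem).contDiffAt)
  have hc2 : ContDiffAt ℂ n (logTheta (qParam τ) 1) 0 :=
    ((DifferentiableOn.analyticAt (fun z hz =>
      (hasDerivAt_logTheta hq hδ 1 hz).differentiableAt.differentiableWithinAt) hmem).contDiffAt)
  have he : deriv (theta4 τ) =ᶠ[𝓝 0] fun z => logTheta (qParam τ) 1 z * theta4 τ z :=
    Filter.eventuallyEq_of_mem hmem fun z hz => (hder z hz).deriv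
  rw [theta4Deriv, iteratedDeriv_succ', he.iteratedDeriv_eq, iteratedDeriv_fun_mul hc2 hc1]
  refine sum_congr rfl fun i _ => ?_
  rw [iteratedDeriv_logTheta hq hδ 1 i (Metric.mem_ball_self h0), add_comm 1 i]
  rfl

lemma logTheta_zero_of_odd (q : ℂ) {j : ℕ} (hj : Odd j) : logTheta q j 0 = 0 := by
  refine (tsum_congr fun m => ?_).trans tsum_zero
  rw [hj.neg_pow, mul_zero, neg_zero, Complex.exp_zero]
  ring

lemma qParam_two_mul (τ : ℂ) : qParam (2 * τ) = qParam τ ^ 2 := by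
  rw [qParam, qParam, ← Complex.exp_nat_mul]
  congr 1; push_cast; ring

lemma summable_Phi {q : ℂ} (hq : ‖q‖ < 1) (s : ℕ) :
    Summable fun n : ℕ+ => ((n : ℕ) : ℂ) ^ s * q ^ (n : ℕ) / (1 - q ^ (n : ℕ)) := by
  have := summable_norm_pow_mul_geometric_div_one_sub s hq
  exact this.comp_injective (i := fun n : ℕ+ => (n : ℕ)) PNat.coe_injective

/-- The even derivatives of `log ϑ₄` at `0`, from
`q^m / (1 - q^{2m}) = q^m / (1 - q^m) - q^{2m} / (1 - q^{2m})`. -/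
theorem logTheta_even {q : ℂ} (hq : ‖q‖ < 1) {ν : ℕ} (hν : 1 ≤ ν) :
    logTheta q (2 * ν) 0
      = (-1) ^ (ν + 1) * (2 * 4 ^ ν) * (Phi (2 * ν - 1) q - Phi (2 * ν - 1) (q ^ 2)) := by
  have hQ : ‖q ^ 2‖ < 1 := by
    rw [norm_pow]; exact pow_lt_one₀ (norm_nonneg _) hq two_ne_zero
  rw [Phi, Phi, ← (summable_Phi hq _).tsum_sub (summable_Phi hQ _), ← tsum_mul_left, logTheta]
  rw [← tsum_subtype_eq_of_support_subset (s := {n : ℕ | 0 < n})]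
  · refine tsum_congr fun m : ℕ+ => ?_
    have hm : ((m : ℕ) : ℂ) ≠ 0 := by exact_mod_cast m.ne_zero
    have h1 := one_sub_pow_ne_zero hq m.ne_zero
    have h2 := one_sub_pow_ne_zero hQ m.ne_zero
    change -logCoeff q m * ((2 * ((m : ℕ) : ℂ) * Complex.I) ^ (2 * ν)
      * Complex.exp (2 * ((m : ℕ) : ℂ) * Complex.I * 0)
      + (-(2 * ((m : ℕ) : ℂ) * Complex.I)) ^ (2 * ν)
      * Complex.exp (-(2 * ((m : ℕ) : ℂ) * Complex.I * 0))) = _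
    have h3 : (2 * ((m : ℕ) : ℂ) * Complex.I) ^ (2 * ν)
        = (-1) ^ ν * 4 ^ ν * (((m : ℕ) : ℂ) * ((m : ℕ) : ℂ) ^ (2 * ν - 1)) := by
      rw [mul_pow, mul_pow, pow_mul Complex.I, Complex.I_sq, pow_mul 2, ← pow_succ',
        Nat.sub_add_cancel (by omega)]
      norm_num
      ring
    rw [(even_two_mul ν).neg_pow, mul_zero, neg_zero, Complex.exp_zero, h3, logCoeff, ← pow_mul q 2,
      mul_comm 2 (m : ℕ), pow_mul q _ 2]
    rw [← pow_mul q 2, mul_comm 2 (m : ℕ), pow_mul q _ 2] at h2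
    set x := q ^ (m : ℕ)
    rw [pow_succ (-1 : ℂ)]
    have h4 : 1 + x ≠ 0 := fun h => h2 (by linear_combination (1 - x) * h)
    rw [show 1 - x ^ 2 = (1 - x) * (1 + x) by ring]
    field_simp
    ring
  · intro m hm
    rw [Set.mem_ofPred_eq]
    refine Nat.pos_of_ne_zero fun h => hm ?_
    simp [h, logCoeff]

/-! ### The identity and the recurrence for the derivatives of `ϑ₄` -/

/-- By Euler's formula for `ζ(2ν)`, a vanishing Bernoulli number would be a zero of `ζ`. -/
lemma bernoulli_two_mul_ne_zero {ν : ℕ} (hν : 1 ≤ ν) : ((bernoulli (2 * ν) : ℚ) : ℂ) ≠ 0 := by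
  intro h
  have h1 := riemannZeta_two_mul_nat (k := ν) (by omega)
  rw [h, mul_zero, zero_div] at h1
  refine riemannZeta_ne_zero_of_one_lt_re ?_ h1
  rw [show (2 * (ν : ℂ)) = ((2 * ν : ℕ) : ℂ) by push_cast; rfl, Complex.natCast_re]
  exact_mod_cast (by omega : 1 < 2 * ν)

lemma Phi_sub_Phi_eq {ν : ℕ} (hν : 1 ≤ ν) (τ : ℂ) :
    Phi (2 * ν - 1) (qParam τ) - Phi (2 * ν - 1) (qParam τ ^ 2)
      = ((bernoulli (2 * ν) : ℚ) : ℂ) / (4 * (ν : ℂ))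
        * (eisensteinE (2 * ν) (2 * τ) - eisensteinE (2 * ν) τ) := by
  have hB := bernoulli_two_mul_ne_zero hν
  have hn : (ν : ℂ) ≠ 0 := by exact_mod_cast (by omega : ν ≠ 0)
  rw [eisensteinE, eisensteinE, qParam_two_mul]
  push_cast
  field_simp
  ring

theorem logTheta_even_eq_eisensteinE {τ : ℂ} (hτ : 0 < τ.im) {ν : ℕ} (hν : 1 ≤ ν) :
    logTheta (qParam τ) (2 * ν) 0
      = (-1) ^ (ν + 1) * (2 * 4 ^ ν) * (((bernoulli (2 * ν) : ℚ) : ℂ) / (4 * (ν : ℂ))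
        * (eisensteinE (2 * ν) (2 * τ) - eisensteinE (2 * ν) τ)) := by
  rw [logTheta_even (norm_qParam_lt_one hτ) hν, Phi_sub_Phi_eq hν]

lemma theta4Deriv_zero (τ : ℂ) : theta4Deriv τ 0 = theta4 τ 0 := by
  rw [theta4Deriv, iteratedDeriv_zero]

lemma theta4_neg (τ z : ℂ) : theta4 τ (-z) = theta4 τ z := by
  rw [theta4_eq_jacobiTheta₂, theta4_eq_jacobiTheta₂, ← jacobiTheta₂_neg_left,
    ← jacobiTheta₂_add_left]
  congr 1; ring

theorem theta4Deriv_of_odd (τ : ℂ) {k : ℕ} (hk : Odd k) : theta4Deriv τ k = 0 := by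
  have h := iteratedDeriv_comp_neg k (theta4 τ) 0
  rw [funext (theta4_neg τ), neg_zero, hk.neg_one_pow, neg_one_smul] at h
  rw [theta4Deriv]
  linear_combination h / 2

/-- The sum over the tuples of Faà di Bruno's formula is `-(log ϑ₄)⁽ⁿ⁾(0)`. -/
theorem sum_faaTerm {τ : ℂ} (hτ : 0 < τ.im) {n : ℕ} (hn : n ≠ 0) :
    ∑ m ∈ faaTuples n, faaTerm τ m = -logTheta (qParam τ) n 0 := by
  have h := sum_faaTuples_log (f := theta4Deriv τ) (l := fun k => logTheta (qParam τ) k 0)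
    (by rw [theta4Deriv_zero]; exact theta4_zero_ne_zero hτ) (theta4Deriv_succ hτ) hn
  rw [theta4Deriv_zero] at h
  exact h

/-- The only tuple with a nonzero last entry is `(0, …, 0, 1)`; its term is `-ϑ₄⁽ⁿ⁾(0) / ϑ₄(0)`. -/
lemma sum_faaTerm_eq (τ : ℂ) {n : ℕ} (hn : n ≠ 0) :
    ∑ m ∈ faaTuples n, faaTerm τ m
      = -theta4Deriv τ n / theta4 τ 0
        + ∑ m ∈ (faaTuples n).filter (fun m => ∀ j : Fin n, (j : ℕ) + 1 = n → m j = 0),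
            faaTerm τ m := by
  obtain ⟨k, rfl⟩ := Nat.exists_eq_succ_of_ne_zero hn
  set e : Fin (k + 1) → ℕ := Pi.single (Fin.last k) 1 with he
  have hpred : ∀ m : Fin (k + 1) → ℕ,
      (∀ j : Fin (k + 1), (j : ℕ) + 1 = k + 1 → m j = 0) ↔ m (Fin.last k) = 0 := fun m =>
    ⟨fun h => h _ (by simp), fun h j hj => by
      rwa [show j = Fin.last k from Fin.ext (by simpa using hj)]⟩
  have hfil : (faaTuples (k + 1)).filter
      (fun m => ¬∀ j : Fin (k + 1), (j : ℕ) + 1 = k + 1 → m j = 0) = {e} := by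
    ext m
    rw [mem_filter, hpred, mem_singleton, mem_faaTuples, Fin.sum_univ_castSucc, Fin.val_last]
    constructor
    · rintro ⟨h1, h2⟩
      have h3 : 1 ≤ m (Fin.last k) := Nat.one_le_iff_ne_zero.mpr h2
      have h4 : m (Fin.last k) = 1 := by
        have h5 : (k + 1) * m (Fin.last k) ≤ (k + 1) * 1 := by omega
        exact le_antisymm (Nat.le_of_mul_le_mul_left h5 k.succ_pos) h3
      rw [h4, mul_one, Nat.add_eq_right, sum_eq_zero_iff] at h1
      funext j
      rcases Fin.eq_castSucc_or_eq_last j with ⟨i, rfl⟩ | rfl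
      · have h5 := h1 i (mem_univ _)
        rw [he, Pi.single_eq_of_ne (Fin.castSucc_ne_last i)]
        exact (Nat.mul_eq_zero.mp h5).resolve_left (Nat.succ_ne_zero _)
      · rw [h4, he, Pi.single_eq_same]
    · rintro rfl
      simp [he, Fin.castSucc_ne_last]
  have hsum : ∑ j, e j = 1 := by rw [he]; simp [Pi.single_apply]
  have hterm : faaTerm τ e = -theta4Deriv τ (k + 1) / theta4 τ 0 := by
    have h1 : ∏ j : Fin (k + 1), (((e j).factorial : ℂ) * ((((j : ℕ) + 1).factorial : ℂ)) ^ e j)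
        = ((k + 1).factorial : ℂ) := by
      rw [prod_eq_single (Fin.last k)]
      · simp [he]
      · intro j _ hj; simp [he, Pi.single_eq_of_ne hj]
      · simp
    have h2 : ∏ j : Fin (k + 1), theta4Deriv τ ((j : ℕ) + 1) ^ e j = theta4Deriv τ (k + 1) := by
      rw [prod_eq_single (Fin.last k)]
      · simp [he]
      · intro j _ hj; simp [he, Pi.single_eq_of_ne hj]
      · simp
    have h3 : ((k + 1).factorial : ℂ) ≠ 0 := by exact_mod_cast (k + 1).factorial_ne_zero
    rw [faaTerm, faaCoeff, h1, h2, hsum, Nat.cast_one, Complex.Gamma_one, div_self h3]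
    ring
  rw [← sum_filter_add_sum_filter_not _
    (fun m => ∀ j : Fin (k + 1), (j : ℕ) + 1 = k + 1 → m j = 0), hfil, sum_singleton, hterm,
    add_comm]

/-! ### Rational polynomials in a family of functions -/

/-- `g` is a polynomial with rational coefficients, of total degree at most `d`, in the functions
`v i`. -/
def IsPolyIn {X ι : Type*} (v : ι → X → ℂ) (d : ℕ) (g : X → ℂ) : Prop :=
  ∃ p : MvPolynomial ι ℚ, p.totalDegree ≤ d ∧
    ∀ x, g x = MvPolynomial.aeval (fun i => v i x) p

namespace IsPolyIn

variable {X ι : Type*} {v : ι → X → ℂ} {d e : ℕ} {f g : X → ℂ}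

lemma mono (h : IsPolyIn v d f) (hde : d ≤ e) : IsPolyIn v e f := by
  obtain ⟨p, hp, hf⟩ := h
  exact ⟨p, hp.trans hde, hf⟩

lemma const (v : ι → X → ℂ) (d : ℕ) (c : ℚ) : IsPolyIn v d fun _ => (c : ℂ) :=
  ⟨MvPolynomial.C c, by simp, fun x => by simp⟩

lemma var (v : ι → X → ℂ) (i : ι) : IsPolyIn v 1 (v i) :=
  ⟨MvPolynomial.X i, by simp, fun x => by simp⟩

lemma add (hf : IsPolyIn v d f) (hg : IsPolyIn v d g) : IsPolyIn v d fun x => f x + g x := by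
  obtain ⟨p, hp, hf⟩ := hf
  obtain ⟨r, hr, hg⟩ := hg
  exact ⟨p + r, (MvPolynomial.totalDegree_add _ _).trans (max_le hp hr), fun x => by
    simp only [map_add, hf, hg]⟩

lemma mul (hf : IsPolyIn v d f) (hg : IsPolyIn v e g) :
    IsPolyIn v (d + e) fun x => f x * g x := by
  obtain ⟨p, hp, hf⟩ := hf
  obtain ⟨r, hr, hg⟩ := hg
  exact ⟨p * r, (MvPolynomial.totalDegree_mul _ _).trans (add_le_add hp hr), fun x => by
    simp only [map_mul, hf, hg]⟩

lemma const_mul (c : ℚ) (hf : IsPolyIn v d f) : IsPolyIn v d fun x => (c : ℂ) * f x := by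
  simpa using (const v 0 c).mul hf

lemma sub (hf : IsPolyIn v d f) (hg : IsPolyIn v d g) : IsPolyIn v d fun x => f x - g x := by
  simpa [sub_eq_add_neg] using hf.add (hg.const_mul (-1))

lemma pow (hf : IsPolyIn v d f) (n : ℕ) : IsPolyIn v (n * d) fun x => f x ^ n := by
  induction n with
  | zero => simpa using const v (0 * d) 1
  | succ n ih => simpa [pow_succ, Nat.succ_mul] using ih.mul hf

lemma sum {κ : Type*} (s : Finset κ) {F : κ → X → ℂ} (h : ∀ k ∈ s, IsPolyIn v d (F k)) :
    IsPolyIn v d fun x => ∑ k ∈ s, F k x := by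
  classical
  induction s using Finset.induction_on with
  | empty => simpa using const v d 0
  | insert a s ha ih =>
    simp_rw [sum_insert ha]
    exact (h a (mem_insert_self a s)).add (ih fun k hk => h k (mem_insert_of_mem hk))

lemma comp {Y κ : Type*} {w : κ → Y → ℂ} (h : IsPolyIn v d f) (φ : Y → X) (σ : ι → κ)
    (hw : ∀ i y, v i (φ y) = w (σ i) y) : IsPolyIn w d fun y => f (φ y) := by
  obtain ⟨p, hp, hf⟩ := h
  refine ⟨MvPolynomial.rename σ p, (MvPolynomial.totalDegree_rename_le _ _).trans hp, fun y => ?_⟩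
  simp only [hf, MvPolynomial.aeval_rename, hw]
  rfl

end IsPolyIn

/-! ### Eisenstein series as polynomials in `E₄` and `E₆` -/

section

open UpperHalfPlane ModularForm MatrixGroups EisensteinSeries

/-- The power series with rational coefficients, as a subring of `ℂ⟦X⟧`. -/
noncomputable def ratSeries : Subring (PowerSeries ℂ) :=
  (PowerSeries.map (algebraMap ℚ ℂ)).range

lemma mem_ratSeries_of_coeff {p : PowerSeries ℂ} (c : ℕ → ℚ)
    (h : ∀ n, PowerSeries.coeff n p = (c n : ℂ)) : p ∈ ratSeries :=
  ⟨PowerSeries.mk c, by ext n; simp [h]⟩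

lemma exists_rat_coeff {p : PowerSeries ℂ} (h : p ∈ ratSeries) (n : ℕ) :
    ∃ c : ℚ, PowerSeries.coeff n p = (c : ℂ) := by
  obtain ⟨r, rfl⟩ := h
  exact ⟨PowerSeries.coeff n r, by simp⟩

lemma rat_smul_mem_ratSeries (c : ℚ) {p : PowerSeries ℂ} (h : p ∈ ratSeries) :
    (c : ℂ) • p ∈ ratSeries := by
  obtain ⟨r, rfl⟩ := h
  exact ⟨c • r, by ext n; simp⟩

/-- Division by a rational series `X + ⋯`, which is `X` times a unit, preserves rationality. -/
lemma mem_ratSeries_of_mul {D g : PowerSeries ℂ} (hD : D ∈ ratSeries)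
    (hD0 : PowerSeries.coeff 0 D = 0) (hD1 : PowerSeries.coeff 1 D = 1) (h : D * g ∈ ratSeries) :
    g ∈ ratSeries := by
  obtain ⟨d, rfl⟩ := hD
  obtain ⟨b, hb⟩ := h
  have hd0 : PowerSeries.constantCoeff d = 0 := by simpa using hD0
  obtain ⟨u, rfl⟩ := PowerSeries.X_dvd_iff.mpr hd0
  have hu : PowerSeries.constantCoeff u ≠ 0 := by
    intro h0
    have : PowerSeries.coeff (0 + 1) (PowerSeries.X * u) = 0 := by
      rw [PowerSeries.coeff_succ_X_mul, PowerSeries.coeff_zero_eq_constantCoeff_apply, h0]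
    rw [PowerSeries.coeff_map, show (1 : ℕ) = 0 + 1 from rfl, this, map_zero] at hD1
    exact zero_ne_one hD1
  have hb0 : PowerSeries.constantCoeff b = 0 := by
    have := congrArg (PowerSeries.coeff 0) hb
    rw [PowerSeries.coeff_map, PowerSeries.coeff_zero_eq_constantCoeff_apply,
      map_mul (PowerSeries.map _), PowerSeries.map_X, mul_assoc,
      PowerSeries.coeff_zero_X_mul] at this
    simpa using this
  obtain ⟨b', rfl⟩ := PowerSeries.X_dvd_iff.mpr hb0
  have hX : (PowerSeries.X : PowerSeries ℂ) ≠ 0 := PowerSeries.X_ne_zero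
  have h1 : PowerSeries.map (algebraMap ℚ ℂ) b' = PowerSeries.map (algebraMap ℚ ℂ) u * g := by
    refine mul_left_cancel₀ hX ?_
    rw [map_mul, map_mul, PowerSeries.map_X] at hb
    rw [hb, mul_assoc]
  refine ⟨u⁻¹ * b', ?_⟩
  rw [map_mul, h1, ← mul_assoc, ← map_mul, PowerSeries.inv_mul_cancel _ hu, map_one, one_mul]

lemma qExpansion_E_mem_ratSeries {k : ℕ} (hk : 3 ≤ k) (hk2 : Even k) :
    qExpansion 1 (E hk) ∈ ratSeries := by
  refine mem_ratSeries_of_coeff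
    (fun m => if m = 0 then 1 else -(2 * k / bernoulli k) * (ArithmeticFunction.sigma (k - 1) m))
    fun m => ?_
  rw [E_qExpansion_coeff hk hk2]
  split_ifs <;> push_cast <;> rfl

lemma qExpansion_discriminant_mem_ratSeries :
    qExpansion 1 ModularForm.discriminant ∈ ratSeries := by
  have h : (ModularForm.discriminant : ℍ → ℂ)
      = ((1 / 1728 : ℚ) : ℂ) • ⇑(ModularForm.mcast (by decide) (E₄.pow 3)
          - ModularForm.mcast (by decide) (E₆.pow 2) : ModularForm 𝒮ℒ 12) := by
    funext z
    simp only [Pi.smul_apply, FunLike.coe_sub, coe_mcast, ModularForm.coe_pow,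
      Pi.sub_apply, Pi.pow_apply,
      discriminant_eq_E₄_cube_sub_E₆_sq, smul_eq_mul]
    push_cast
    ring
  rw [h, ModularForm.qExpansion_smul one_pos one_mem_strictPeriods_SL]
  refine rat_smul_mem_ratSeries _ ?_
  simp only [FunLike.coe_sub, coe_mcast,
    ModularForm.qExpansion_sub one_pos one_mem_strictPeriods_SL,
    ModularForm.qExpansion_pow one_pos one_mem_strictPeriods_SL]
  exact sub_mem (pow_mem (qExpansion_E_mem_ratSeries _ ⟨2, rfl⟩) _)
    (pow_mem (qExpansion_E_mem_ratSeries _ ⟨3, rfl⟩) _)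

lemma isPolyIn_of_weight_zero {v : Fin 2 → ℍ → ℂ} {f : ModularForm 𝒮ℒ 0}
    (hf : qExpansion 1 f ∈ ratSeries) (d : ℕ) : IsPolyIn v d f := by
  obtain ⟨c, hc⟩ := ModularFormClass.levelOne_weight_zero_const f
  have h1 : (⇑f : ℍ → ℂ) = c • ⇑(1 : ModularForm 𝒮ℒ 0) := by
    rw [hc]; funext z; simp
  rw [h1, ModularForm.qExpansion_smul one_pos one_mem_strictPeriods_SL,
    ModularForm.qExpansion_one] at hf
  obtain ⟨r, hr⟩ := exists_rat_coeff hf 0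
  have h2 : c = (r : ℂ) := by simpa using hr
  rw [hc, h2]
  exact IsPolyIn.const v d r

/-- A modular form of level one with rational `q`-expansion is a rational polynomial in `E₄` and
`E₆`: subtract a multiple of a monomial `E₄^a E₆^b` to reach a cusp form, divide by the
discriminant, and use induction on the weight. -/
theorem isPolyIn_E₄_E₆ {k : ℕ} (f : ModularForm 𝒮ℒ (k : ℤ)) (hf : qExpansion 1 f ∈ ratSeries) :
    IsPolyIn ![⇑E₄, ⇑E₆] (k / 2) f := by
  induction k using Nat.strong_induction_on with
  | _ k ih =>
  have hzero : ∀ f : ModularForm 𝒮ℒ (k : ℤ), f = 0 → IsPolyIn ![⇑E₄, ⇑E₆] (k / 2) f := by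
    rintro _ rfl
    have h := IsPolyIn.const ![⇑E₄, ⇑E₆] (k / 2) 0
    rw [Rat.cast_zero] at h
    exact h
  rcases Nat.even_or_odd k with hk | hk
  swap
  · exact hzero f (levelOne_odd_weight_eq_zero (by exact_mod_cast hk) f)
  rcases eq_or_ne k 0 with rfl | hk0
  · exact isPolyIn_of_weight_zero hf _
  rcases eq_or_ne k 2 with rfl | hk2
  · exact hzero f (rank_zero_iff_forall_zero.mp levelOne_weight_two_rank_zero f)
  obtain ⟨a, b, hab⟩ : ∃ a b : ℕ, k = 4 * a + 6 * b := by
    obtain ⟨m, rfl⟩ := hk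
    rcases Nat.even_or_odd m with ⟨c, rfl⟩ | ⟨c, rfl⟩
    · exact ⟨c, 0, by ring⟩
    · exact ⟨c - 1, 1, by omega⟩
  let g : ModularForm 𝒮ℒ (k : ℤ) :=
    ModularForm.mcast (by rw [hab]; push_cast; ring) ((E₄.pow a).mul (E₆.pow b))
  have hg : ∀ z, g z = E₄ z ^ a * E₆ z ^ b := fun z => by
    simp [g, ModularForm.mcast_apply]
  have hgq : qExpansion 1 g = qExpansion 1 E₄ ^ a * qExpansion 1 E₆ ^ b := by
    simp only [g, coe_mcast, ModularForm.qExpansion_mul one_pos one_mem_strictPeriods_SL,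
      ModularForm.qExpansion_pow one_pos one_mem_strictPeriods_SL]
  have hgr : qExpansion 1 g ∈ ratSeries := by
    rw [hgq]
    exact mul_mem (pow_mem (qExpansion_E_mem_ratSeries _ ⟨2, rfl⟩) _)
      (pow_mem (qExpansion_E_mem_ratSeries _ ⟨3, rfl⟩) _)
  have hg0 : PowerSeries.coeff 0 (qExpansion 1 g) = 1 := by
    have h4 := E_qExpansion_coeff_zero (k := 4) (by norm_num) ⟨2, rfl⟩
    have h6 := E_qExpansion_coeff_zero (k := 6) (by norm_num) ⟨3, rfl⟩
    rw [PowerSeries.coeff_zero_eq_constantCoeff_apply] at h4 h6 ⊢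
    rw [hgq, map_mul, map_pow, map_pow]
    erw [h4, h6]
    simp
  obtain ⟨c, hc⟩ := exists_rat_coeff hf 0
  let F : ModularForm 𝒮ℒ (k : ℤ) := f - (c : ℂ) • g
  have hFq : qExpansion 1 F = qExpansion 1 f - (c : ℂ) • qExpansion 1 g := by
    rw [FunLike.coe_sub, ModularForm.qExpansion_sub one_pos one_mem_strictPeriods_SL,
      FunLike.coe_smul, ModularForm.qExpansion_smul one_pos one_mem_strictPeriods_SL]
  have hF0 : PowerSeries.coeff 0 (qExpansion 1 F) = 0 := by
    rw [hFq, map_sub, PowerSeries.coeff_smul, hc, hg0, smul_eq_mul, mul_one, sub_self]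
  have hFr : qExpansion 1 F ∈ ratSeries := by
    rw [hFq]; exact sub_mem hf (rat_smul_mem_ratSeries c hgr)
  have hgp : IsPolyIn ![⇑E₄, ⇑E₆] (k / 2) g := by
    rw [show (⇑g : ℍ → ℂ) = fun z => E₄ z ^ a * E₆ z ^ b from funext hg]
    exact (((IsPolyIn.var ![⇑E₄, ⇑E₆] 0).pow a).mul
      ((IsPolyIn.var ![⇑E₄, ⇑E₆] 1).pow b)).mono (by omega)
  have hfF : (⇑f : ℍ → ℂ) = fun z => F z + (c : ℂ) * g z := by
    funext z
    simp [F]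
  rw [hfF]
  refine IsPolyIn.add ?_ (hgp.const_mul c)
  set G := CuspForm.discriminantEquiv (toCuspForm F hF0) with hG
  have hFG : ∀ z, F z = ModularForm.discriminant z * G z := fun z => by
    rw [hG, ModularForm.discriminant_mul_discriminantEquiv_apply, toCuspForm_apply]
  rcases lt_or_ge k 12 with hk12 | hk12
  · have hG0 : G = 0 :=
      rank_zero_iff_forall_zero.mp (levelOne_neg_weight_rank_zero (by omega)) G
    refine hzero F ?_
    ext z
    rw [hFG, hG0]
    simp
  · have hGr : qExpansion 1 G ∈ ratSeries := by
      have h1 := qExpansion_eq_qExpansion_discriminant_mul F hF0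
      refine mem_ratSeries_of_mul qExpansion_discriminant_mem_ratSeries ?_
        discriminant_qExpansion_coeff_one (h1 ▸ hFr)
      exact PowerSeries.coeff_of_lt_order _ (by rw [discriminant_qExpansion_order]; simp)
    have h2 := ih (k - 12) (by omega)
      (ModularForm.mcast (by omega : (k : ℤ) - 12 = ((k - 12 : ℕ) : ℤ)) G) hGr
    have h3 : IsPolyIn ![⇑E₄, ⇑E₆] 3 ModularForm.discriminant := by
      have h4 : (ModularForm.discriminant : ℍ → ℂ)
          = fun z => ((1 / 1728 : ℚ) : ℂ) * (E₄ z ^ 3 - E₆ z ^ 2) := by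
        funext z
        rw [discriminant_eq_E₄_cube_sub_E₆_sq]
        push_cast
        ring
      rw [h4]
      exact (((IsPolyIn.var ![⇑E₄, ⇑E₆] 0).pow 3).sub
        (((IsPolyIn.var ![⇑E₄, ⇑E₆] 1).pow 2).mono (by norm_num))).const_mul _
    rw [show (⇑F : ℍ → ℂ) = fun z => ModularForm.discriminant z * G z from funext hFG]
    exact (h3.mul h2).mono (by omega)

lemma eisensteinE_eq_E {k : ℕ} (hk : 3 ≤ k) (hk2 : Even k) (z : ℍ) :
    eisensteinE k z = E hk z := by
  rw [q_expansion_bernoulli hk hk2, eisensteinE, Phi,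
    tsum_pow_div_one_sub_eq_tsum_sigma (norm_qParam_lt_one z.im_pos)]
  simp only [zpow_natCast]
  rfl

lemma ramP_eq_eisensteinE (τ : ℂ) : ramP (qParam τ) = eisensteinE 2 τ := by
  rw [ramP, eisensteinE, show bernoulli 2 = 1 / 6 by decide +kernel]
  norm_num

lemma ramQ_eq_E₄ (z : ℍ) : ramQ (qParam z) = E₄ z := by
  rw [← eisensteinE_eq_E (by norm_num) ⟨2, rfl⟩, ramQ, eisensteinE,
    show bernoulli 4 = -1 / 30 by decide +kernel]
  norm_num

lemma ramR_eq_E₆ (z : ℍ) : ramR (qParam z) = E₆ z := by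
  rw [← eisensteinE_eq_E (by norm_num) ⟨3, rfl⟩, ramR, eisensteinE,
    show bernoulli 6 = 1 / 42 by decide +kernel]
  norm_num

/-- The functions `P, Q, R` at `q` and at `q²`, on the upper half-plane. -/
noncomputable def pqr : Fin 6 → ℍ → ℂ :=
  ![fun τ => ramP (qParam τ), fun τ => ramQ (qParam τ), fun τ => ramR (qParam τ),
    fun τ => ramP (qParam τ ^ 2), fun τ => ramQ (qParam τ ^ 2), fun τ => ramR (qParam τ ^ 2)]

lemma isPolyIn_eisensteinE {ν : ℕ} (hν : 1 ≤ ν) :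
    IsPolyIn pqr ν (fun τ : ℍ => eisensteinE (2 * ν) τ) ∧
      IsPolyIn pqr ν (fun τ : ℍ => eisensteinE (2 * ν) (2 * τ)) := by
  rcases hν.eq_or_lt with rfl | hν
  · constructor
    · simp_rw [mul_one, ← ramP_eq_eisensteinE]
      exact IsPolyIn.var pqr 0
    · simp_rw [mul_one, ← ramP_eq_eisensteinE, qParam_two_mul]
      exact IsPolyIn.var pqr 3
  · have hk : 3 ≤ 2 * ν := by omega
    have hE := isPolyIn_E₄_E₆ (E hk) (qExpansion_E_mem_ratSeries hk (even_two_mul ν))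
    rw [Nat.mul_div_cancel_left ν two_pos] at hE
    have hd : ∀ τ : ℍ, 0 < (2 * (τ : ℂ)).im := fun τ => im_two_mul_pos τ.im_pos
    constructor
    · simp_rw [eisensteinE_eq_E hk (even_two_mul ν)]
      refine hE.comp id ![1, 2] fun i τ => ?_
      fin_cases i
      · exact (ramQ_eq_E₄ τ).symm
      · exact (ramR_eq_E₆ τ).symm
    · have h1 : ∀ τ : ℍ, eisensteinE (2 * ν) (2 * τ) = E hk ⟨2 * τ, hd τ⟩ := fun τ =>
        eisensteinE_eq_E hk (even_two_mul ν) ⟨2 * τ, hd τ⟩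
      simp_rw [h1]
      refine hE.comp (fun τ : ℍ => ⟨2 * τ, hd τ⟩) ![4, 5] fun i τ => ?_
      fin_cases i
      · refine (ramQ_eq_E₄ ⟨2 * τ, hd τ⟩).symm.trans ?_
        exact congrArg ramQ (qParam_two_mul τ)
      · refine (ramR_eq_E₆ ⟨2 * τ, hd τ⟩).symm.trans ?_
        exact congrArg ramR (qParam_two_mul τ)

/-- Induction on `n`, by Leibniz's rule: the derivatives of `log ϑ₄` that occur are zero in odd
order, and differences of Eisenstein series of weight `2j + 2` in order `2j + 2`. -/
theorem isPolyIn_theta4Deriv (n : ℕ) :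
    IsPolyIn pqr n (fun τ : ℍ => theta4Deriv τ (2 * n) / theta4 τ 0) := by
  induction n using Nat.strong_induction_on with
  | _ n ih =>
  rcases n with _ | n
  · have h : ∀ τ : ℍ, theta4Deriv τ (2 * 0) / theta4 τ 0 = ((1 : ℚ) : ℂ) := fun τ => by
      rw [mul_zero, theta4Deriv_zero, div_self (theta4_zero_ne_zero τ.im_pos), Rat.cast_one]
    simp_rw [h]
    exact IsPolyIn.const pqr 0 1
  · have h : ∀ τ : ℍ, theta4Deriv τ (2 * (n + 1)) / theta4 τ 0
        = ∑ i ∈ range (2 * n + 1 + 1), ((2 * n + 1).choose i : ℂ)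
          * logTheta (qParam τ) (i + 1) 0 * (theta4Deriv τ (2 * n + 1 - i) / theta4 τ 0) :=
      fun τ => by
        rw [show 2 * (n + 1) = 2 * n + 1 + 1 by ring, theta4Deriv_succ τ.im_pos, sum_div]
        exact sum_congr rfl fun i _ => by ring
    simp_rw [h]
    refine IsPolyIn.sum _ fun i hi => ?_
    rw [mem_range] at hi
    rcases Nat.even_or_odd i with hi2 | ⟨j, rfl⟩
    · simp_rw [logTheta_zero_of_odd _ hi2.add_one, mul_zero, zero_mul]
      simpa using IsPolyIn.const pqr (n + 1) 0
    · have hl : ∀ τ : ℍ, logTheta (qParam τ) (2 * j + 1 + 1) 0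
          = (((-1) ^ (j + 1 + 1) * (2 * 4 ^ (j + 1))
              * (bernoulli (2 * (j + 1)) / (4 * (j + 1 : ℕ))) : ℚ) : ℂ)
            * (eisensteinE (2 * (j + 1)) (2 * τ) - eisensteinE (2 * (j + 1)) τ) := fun τ => by
        rw [show 2 * j + 1 + 1 = 2 * (j + 1) by ring,
          logTheta_even_eq_eisensteinE τ.im_pos (by omega)]
        push_cast
        ring
      obtain ⟨e1, e2⟩ := isPolyIn_eisensteinE (ν := j + 1) (by omega)
      have h1 := ((e2.sub e1).const_mul ((-1) ^ (j + 1 + 1) * (2 * 4 ^ (j + 1))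
              * (bernoulli (2 * (j + 1)) / (4 * (j + 1 : ℕ))))).const_mul
                ((2 * n + 1).choose (2 * j + 1))
      have h2 := ih (n - j) (by omega)
      rw [show 2 * (n - j) = 2 * n + 1 - (2 * j + 1) by omega] at h2
      have h3 := (h1.mul h2).mono (show j + 1 + (n - j) ≤ n + 1 by omega)
      simp_rw [hl]
      simpa using h3

lemma evalPQR_add (d : ℕ) (c c' : ℕ → ℕ → ℕ → ℕ → ℕ → ℕ → ℚ) (q : ℂ) :
    evalPQR d (fun i j k l m n => c i j k l m n + c' i j k l m n) q
      = evalPQR d c q + evalPQR d c' q := by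
  simp only [evalPQR, Rat.cast_add, add_mul, sum_add_distrib]

lemma evalPQR_zero (d : ℕ) (q : ℂ) : evalPQR d (fun _ _ _ _ _ _ => 0) q = 0 := by
  simp [evalPQR]

lemma evalPQR_single (d : ℕ) (a : ℚ) (s : Fin 6 → ℕ) (hs : ∀ i, s i ≤ d) (τ : ℍ) :
    evalPQR d (fun i j k l m n => if i = s 0 then if j = s 1 then if k = s 2 then if l = s 3 then
        if m = s 4 then if n = s 5 then a else 0 else 0 else 0 else 0 else 0 else 0) (qParam τ)
      = a * ∏ i, pqr i τ ^ s i := by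
  have hs' : ∀ i, s i ∈ range (d + 1) := fun i => mem_range.mpr (Nat.lt_succ_of_le (hs i))
  rw [evalPQR, sum_eq_single_of_mem _ (hs' 0) (fun i _ h => by simp [h]),
    sum_eq_single_of_mem _ (hs' 1) (fun i _ h => by simp [h]),
    sum_eq_single_of_mem _ (hs' 2) (fun i _ h => by simp [h]),
    sum_eq_single_of_mem _ (hs' 3) (fun i _ h => by simp [h]),
    sum_eq_single_of_mem _ (hs' 4) (fun i _ h => by simp [h]),
    sum_eq_single_of_mem _ (hs' 5) (fun i _ h => by simp [h]), Fin.prod_univ_six]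
  simp only [if_true, pqr]
  simp only [Matrix.cons_val]
  ring

/-- A bound on the total degree bounds every exponent, so a polynomial of total degree at most `d`
fits into the box of exponents of `evalPQR`. -/
lemma exists_evalPQR {d : ℕ} {f : ℍ → ℂ} (hf : IsPolyIn pqr d f) :
    ∃ c : ℕ → ℕ → ℕ → ℕ → ℕ → ℕ → ℚ, ∀ τ : ℍ, f τ = evalPQR d c (qParam τ) := by
  obtain ⟨p, hp, hf⟩ := hf
  have key : ∀ s : Finset (Fin 6 →₀ ℕ), s ⊆ p.support →
      ∃ c : ℕ → ℕ → ℕ → ℕ → ℕ → ℕ → ℚ, ∀ τ : ℍ,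
        ∑ e ∈ s, ((p.coeff e : ℚ) : ℂ) * ∏ i, pqr i τ ^ e i = evalPQR d c (qParam τ) := by
    intro s
    induction s using Finset.induction_on with
    | empty => exact fun _ => ⟨_, fun τ => by rw [sum_empty, evalPQR_zero]⟩
    | insert e s he ih =>
      intro hs
      obtain ⟨c, hc⟩ := ih fun x hx => hs (mem_insert_of_mem hx)
      have hdeg : ∀ i, e i ≤ d := fun i => by
        refine le_trans ?_ ((MvPolynomial.le_totalDegree (hs (mem_insert_self e s))).trans hp)
        rw [Finsupp.sum_fintype _ _ fun _ => rfl]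
        exact single_le_sum (f := fun i => e i) (fun _ _ => Nat.zero_le _) (mem_univ i)
      exact ⟨_, fun τ => (sum_insert he).trans ((congrArg₂ (· + ·)
        (evalPQR_single d _ e hdeg τ).symm (hc τ)).trans (evalPQR_add d _ c _).symm)⟩
  obtain ⟨c, hc⟩ := key p.support subset_rfl
  refine ⟨c, fun τ => ?_⟩
  rw [← hc, hf, MvPolynomial.aeval_eq_eval₂Hom, MvPolynomial.coe_eval₂Hom, MvPolynomial.eval₂_eq']
  simp

end

/-! ### Gauss's transformation of the elliptic integral -/

/-- The integral `∫_0^{π/2} dφ / √(a² cos² φ + b² sin² φ)`. -/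
noncomputable def gaussIntegral (a b : ℝ) : ℝ :=
  ∫ φ in (0 : ℝ)..(Real.pi / 2), 1 / √(a ^ 2 * Real.cos φ ^ 2 + b ^ 2 * Real.sin φ ^ 2)

lemma gauss_radicand_pos {a b : ℝ} (ha : 0 < a) (hb : 0 < b) (φ : ℝ) :
    0 < a ^ 2 * Real.cos φ ^ 2 + b ^ 2 * Real.sin φ ^ 2 := by
  rcases eq_or_ne (Real.cos φ) 0 with h | h
  · have h1 : Real.sin φ ^ 2 = 1 := by
      have := Real.sin_sq_add_cos_sq φ
      rw [h] at this
      linarith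
    rw [h, h1]
    positivity
  · have := pow_pos ha 2
    have : 0 < Real.cos φ ^ 2 := by positivity
    positivity

lemma continuous_gauss_integrand {a b : ℝ} (ha : 0 < a) (hb : 0 < b) :
    Continuous fun φ : ℝ => 1 / √(a ^ 2 * Real.cos φ ^ 2 + b ^ 2 * Real.sin φ ^ 2) := by
  refine continuous_const.div (by fun_prop) fun φ => ?_
  exact (Real.sqrt_pos.mpr (gauss_radicand_pos ha hb φ)).ne'

/-- The angle `φ₁` with `tan (φ₁ - φ) = (b / a) tan φ`, in the form
`2 φ - arctan ((a - b) sin φ cos φ / (a cos² φ + b sin² φ))`, which has no singularity at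
`π / 2`. -/
noncomputable def landenAngle (a b φ : ℝ) : ℝ :=
  2 * φ - Real.arctan ((a - b) * Real.sin φ * Real.cos φ
    / (a * Real.cos φ ^ 2 + b * Real.sin φ ^ 2))

lemma landen_den_pos {a b : ℝ} (ha : 0 < a) (hb : 0 < b) (φ : ℝ) :
    0 < a * Real.cos φ ^ 2 + b * Real.sin φ ^ 2 := by
  have := gauss_radicand_pos (Real.sqrt_pos.mpr ha) (Real.sqrt_pos.mpr hb) φ
  rwa [Real.sq_sqrt ha.le, Real.sq_sqrt hb.le] at this

/-- The complex number `(a cos φ + i b sin φ) (cos φ - i sin φ)`, which determines `landenAngle`,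
has the norm of `a cos φ + i b sin φ`. -/
lemma landen_norm_sq (a b φ : ℝ) :
    (a * Real.cos φ ^ 2 + b * Real.sin φ ^ 2) ^ 2 + ((a - b) * Real.sin φ * Real.cos φ) ^ 2
      = a ^ 2 * Real.cos φ ^ 2 + b ^ 2 * Real.sin φ ^ 2 := by
  rw [show Real.cos φ ^ 2 = 1 - Real.sin φ ^ 2 from Real.cos_sq' φ,
    mul_pow, mul_pow, show Real.cos φ ^ 2 = 1 - Real.sin φ ^ 2 from Real.cos_sq' φ]
  ring

lemma hasDerivAt_landenAngle {a b : ℝ} (ha : 0 < a) (hb : 0 < b) (φ : ℝ) :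
    HasDerivAt (landenAngle a b)
      ((a ^ 2 * Real.cos φ ^ 2 + b ^ 2 * Real.sin φ ^ 2 + a * b)
        / (a ^ 2 * Real.cos φ ^ 2 + b ^ 2 * Real.sin φ ^ 2)) φ := by
  have hM := landen_den_pos ha hb φ
  have hD := gauss_radicand_pos ha hb φ
  have hN := landen_norm_sq a b φ
  have hs := Real.hasDerivAt_sin φ
  have hc := Real.hasDerivAt_cos φ
  have h1 := ((hs.const_mul (a - b)).mul hc).div
    (((hc.pow 2).const_mul a).add ((hs.pow 2).const_mul b)) hM.ne'
  have h2 := ((hasDerivAt_id φ).const_mul 2).sub h1.arctan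
  refine h2.congr_deriv ?_
  have hcs := Real.cos_sq' φ
  simp only [Pi.mul_apply, Pi.add_apply, Pi.div_apply, Pi.pow_apply] at *
  set s := Real.sin φ
  set c := Real.cos φ
  have h3 : 1 + ((a - b) * s * c / (a * c ^ 2 + b * s ^ 2)) ^ 2
      = (a ^ 2 * c ^ 2 + b ^ 2 * s ^ 2) / (a * c ^ 2 + b * s ^ 2) ^ 2 := by
    rw [← hN]
    field_simp
  rw [h3, eq_div_iff hD.ne']
  field_simp
  have hc4 : c ^ 4 = (1 - s ^ 2) ^ 2 := by rw [← hcs]; ring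
  ring_nf
  simp only [hc4, hcs]
  ring

lemma cos_landenAngle_sq {a b : ℝ} (ha : 0 < a) (hb : 0 < b) (φ : ℝ) :
    Real.cos (landenAngle a b φ) ^ 2 = (a * Real.cos φ ^ 2 - b * Real.sin φ ^ 2) ^ 2
      / (a ^ 2 * Real.cos φ ^ 2 + b ^ 2 * Real.sin φ ^ 2) := by
  have hM := landen_den_pos ha hb φ
  have hD := gauss_radicand_pos ha hb φ
  have hN := landen_norm_sq a b φ
  have hcs := Real.cos_sq' φ
  rw [landenAngle, Real.cos_sub, Real.cos_arctan, Real.sin_arctan, Real.cos_two_mul,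
    Real.sin_two_mul]
  set s := Real.sin φ
  set c := Real.cos φ
  set M := a * c ^ 2 + b * s ^ 2 with hMdef
  have h3 : 1 + ((a - b) * s * c / M) ^ 2 = (a ^ 2 * c ^ 2 + b ^ 2 * s ^ 2) / M ^ 2 := by
    rw [← hN]
    field_simp
  rw [h3]
  set S := √((a ^ 2 * c ^ 2 + b ^ 2 * s ^ 2) / M ^ 2) with hS
  have hS2 : S ^ 2 = (a ^ 2 * c ^ 2 + b ^ 2 * s ^ 2) / M ^ 2 := Real.sq_sqrt (by positivity)
  have hSpos : 0 < S := Real.sqrt_pos.mpr (by positivity)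
  have h4 : (2 * c ^ 2 - 1) * (1 / S) + 2 * s * c * ((a - b) * s * c / M / S)
      = (a * c ^ 2 - b * s ^ 2) / (M * S) := by
    field_simp
    rw [hMdef]
    have hc4 : c ^ 4 = (1 - s ^ 2) ^ 2 := by rw [← hcs]; ring
    ring_nf
    simp only [hc4, hcs]
    ring
  rw [h4, div_pow, mul_pow, hS2]
  field_simp

/-- Gauss's transformation: the integral is invariant under a step of the
arithmetic-geometric mean. -/
theorem gaussIntegral_agm {a b : ℝ} (ha : 0 < a) (hb : 0 < b) :
    gaussIntegral ((a + b) / 2) √(a * b) = gaussIntegral a b := by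
  have ha1 : 0 < (a + b) / 2 := by positivity
  have hb1 : 0 < √(a * b) := Real.sqrt_pos.mpr (by positivity)
  set g : ℝ → ℝ := fun φ =>
    1 / √(((a + b) / 2) ^ 2 * Real.cos φ ^ 2 + √(a * b) ^ 2 * Real.sin φ ^ 2) with hg
  have hgc : Continuous g := continuous_gauss_integrand ha1 hb1
  have h0 : landenAngle a b 0 = 0 := by simp [landenAngle]
  have hpi : landenAngle a b (Real.pi / 2) = Real.pi := by
    simp [landenAngle]; ring
  have hfc : Continuous fun φ : ℝ => (a ^ 2 * Real.cos φ ^ 2 + b ^ 2 * Real.sin φ ^ 2 + a * b)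
        / (a ^ 2 * Real.cos φ ^ 2 + b ^ 2 * Real.sin φ ^ 2) :=
    Continuous.div (by fun_prop) (by fun_prop) fun φ => (gauss_radicand_pos ha hb φ).ne'
  have hsub := intervalIntegral.integral_comp_mul_deriv (a := 0) (b := Real.pi / 2)
    (fun φ _ => hasDerivAt_landenAngle ha hb φ) hfc.continuousOn hgc
  rw [h0, hpi] at hsub
  have hpt : ∀ φ : ℝ, (g ∘ landenAngle a b) φ
        * ((a ^ 2 * Real.cos φ ^ 2 + b ^ 2 * Real.sin φ ^ 2 + a * b)
          / (a ^ 2 * Real.cos φ ^ 2 + b ^ 2 * Real.sin φ ^ 2))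
      = 2 * (1 / √(a ^ 2 * Real.cos φ ^ 2 + b ^ 2 * Real.sin φ ^ 2)) := fun φ => by
    have hD := gauss_radicand_pos ha hb φ
    have hcs := Real.cos_sq' φ
    simp only [Function.comp_apply, hg]
    rw [Real.sq_sqrt (by positivity), Real.sin_sq, cos_landenAngle_sq ha hb]
    set s := Real.sin φ
    set c := Real.cos φ
    set D := a ^ 2 * c ^ 2 + b ^ 2 * s ^ 2 with hDdef
    have h1 : ((a + b) / 2) ^ 2 * ((a * c ^ 2 - b * s ^ 2) ^ 2 / D)
        + a * b * (1 - (a * c ^ 2 - b * s ^ 2) ^ 2 / D) = ((D + a * b) / 2) ^ 2 / D := by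
      field_simp
      rw [hDdef, hcs]
      ring
    rw [h1, Real.sqrt_div (by positivity), Real.sqrt_sq (by positivity)]
    have hS : 0 < √D := Real.sqrt_pos.mpr hD
    have hS2 : √D ^ 2 = D := Real.sq_sqrt hD.le
    have hab : D + a * b ≠ 0 := by positivity
    field_simp
    rw [hS2]
  -- The angle runs over `[0, π]` while `φ` runs over `[0, π / 2]`; this cancels the factor `2`.
  have hsym : ∫ u in (Real.pi / 2)..Real.pi, g u = ∫ u in (0 : ℝ)..(Real.pi / 2), g u := by
    have h1 := intervalIntegral.integral_comp_sub_left (a := 0) (b := Real.pi / 2) g Real.pi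
    rw [sub_zero, show Real.pi - Real.pi / 2 = Real.pi / 2 by ring] at h1
    rw [← h1]
    refine intervalIntegral.integral_congr fun x _ => ?_
    simp only [hg, Real.cos_pi_sub, Real.sin_pi_sub, neg_sq]
  have hadd := intervalIntegral.integral_add_adjacent_intervals
    (hgc.intervalIntegrable (μ := MeasureTheory.volume) 0 (Real.pi / 2))
    (hgc.intervalIntegrable (μ := MeasureTheory.volume) (Real.pi / 2) Real.pi)
  rw [hsym, ← hsub] at hadd
  simp_rw [hpt] at hadd
  rw [intervalIntegral.integral_const_mul] at hadd
  rw [gaussIntegral, gaussIntegral]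
  linarith

lemma gaussIntegral_smul {a b c : ℝ} (hc : 0 < c) :
    gaussIntegral (c * a) (c * b) = gaussIntegral a b / c := by
  rw [gaussIntegral, gaussIntegral, ← intervalIntegral.integral_div]
  refine intervalIntegral.integral_congr fun φ _ => ?_
  rw [show (c * a) ^ 2 * Real.cos φ ^ 2 + (c * b) ^ 2 * Real.sin φ ^ 2
    = c ^ 2 * (a ^ 2 * Real.cos φ ^ 2 + b ^ 2 * Real.sin φ ^ 2) by ring,
    Real.sqrt_mul (by positivity), Real.sqrt_sq hc.le]
  rw [div_div, mul_comm c]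

lemma gaussIntegral_self {a : ℝ} (ha : 0 < a) : gaussIntegral a a = Real.pi / 2 / a := by
  have h : ∀ φ : ℝ, 1 / √(a ^ 2 * Real.cos φ ^ 2 + a ^ 2 * Real.sin φ ^ 2) = 1 / a := fun φ => by
    rw [← mul_add, Real.cos_sq_add_sin_sq, mul_one, Real.sqrt_sq ha.le]
  simp only [gaussIntegral, h, intervalIntegral.integral_const, smul_eq_mul]
  ring

lemma gaussIntegral_anti {a b a' b' : ℝ} (ha : 0 < a) (hb : 0 < b) (haa : a ≤ a') (hbb : b ≤ b') :
    gaussIntegral a' b' ≤ gaussIntegral a b := by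
  refine intervalIntegral.integral_mono_on (by positivity)
    ((continuous_gauss_integrand (ha.trans_le haa) (hb.trans_le hbb)).intervalIntegrable _ _)
    ((continuous_gauss_integrand ha hb).intervalIntegrable _ _) fun φ _ => ?_
  have := Real.sqrt_pos.mpr (gauss_radicand_pos ha hb φ)
  gcongr

lemma tendsto_gaussIntegral_one {u v : ℕ → ℝ} (hu : ∀ n, 0 < u n) (hv : ∀ n, 0 < v n)
    (hu1 : Tendsto u atTop (𝓝 1)) (hv1 : Tendsto v atTop (𝓝 1)) :
    Tendsto (fun n => gaussIntegral (u n) (v n)) atTop (𝓝 (Real.pi / 2)) := by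
  have h1 : Tendsto (fun n => Real.pi / 2 / max (u n) (v n)) atTop (𝓝 (Real.pi / 2)) := by
    have h := (tendsto_const_nhds (x := Real.pi / 2)).div (hu1.max hv1) (by simp)
    rw [max_self, div_one] at h
    exact h
  have h2 : Tendsto (fun n => Real.pi / 2 / min (u n) (v n)) atTop (𝓝 (Real.pi / 2)) := by
    have h := (tendsto_const_nhds (x := Real.pi / 2)).div (hu1.min hv1) (by simp)
    rw [min_self, div_one] at h
    exact h
  refine tendsto_of_tendsto_of_tendsto_of_le_of_le h1 h2 (fun n => ?_) fun n => ?_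
  · have h0 : 0 < max (u n) (v n) := (hu n).trans_le (le_max_left _ _)
    simp only
    rw [← gaussIntegral_self h0]
    exact gaussIntegral_anti (hu n) (hv n) (le_max_left _ _) (le_max_right _ _)
  · have h0 : 0 < min (u n) (v n) := lt_min (hu n) (hv n)
    simp only
    rw [← gaussIntegral_self h0]
    exact gaussIntegral_anti h0 h0 (min_le_left _ _) (min_le_right _ _)

/-! ### The complete elliptic integral -/

lemma ellipticK_eq_gaussIntegral {x y : ℝ} (h : x ^ 2 + y ^ 2 = 1) :
    ellipticK x = gaussIntegral 1 y := by
  rw [ellipticK, gaussIntegral]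
  refine intervalIntegral.integral_congr fun φ _ => ?_
  congr 2
  rw [Real.cos_sq']
  linear_combination -(Real.sin φ ^ 2) * h

lemma ellipticK_radicand_pos {x : ℝ} (h0 : 0 ≤ x) (h1 : x < 1) (φ : ℝ) :
    0 < 1 - x ^ 2 * Real.sin φ ^ 2 := by
  have h2 : x ^ 2 < 1 := by nlinarith
  nlinarith [Real.sin_sq_le_one φ, sq_nonneg (Real.sin φ), sq_nonneg x]

lemma continuous_ellipticK_integrand {x : ℝ} (h0 : 0 ≤ x) (h1 : x < 1) :
    Continuous fun φ : ℝ => 1 / √(1 - x ^ 2 * Real.sin φ ^ 2) :=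
  continuous_const.div (by fun_prop) fun φ =>
    (Real.sqrt_pos.mpr (ellipticK_radicand_pos h0 h1 φ)).ne'

lemma ellipticK_pos {x : ℝ} (h0 : 0 ≤ x) (h1 : x < 1) : 0 < ellipticK x :=
  intervalIntegral.intervalIntegral_pos_of_pos
    ((continuous_ellipticK_integrand h0 h1).intervalIntegrable _ _)
    (fun φ => one_div_pos.mpr (Real.sqrt_pos.mpr (ellipticK_radicand_pos h0 h1 φ)))
    (by positivity)

lemma ellipticK_lt {x y : ℝ} (h0 : 0 ≤ x) (hxy : x < y) (h1 : y < 1) :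
    ellipticK x < ellipticK y := by
  have hsq : x ^ 2 < y ^ 2 := pow_lt_pow_left₀ hxy h0 two_ne_zero
  have hpos := ellipticK_radicand_pos (h0.trans hxy.le) h1
  refine intervalIntegral.integral_lt_integral_of_continuousOn_of_le_of_exists_lt
    (by positivity) (continuous_ellipticK_integrand h0 (hxy.trans h1)).continuousOn
    (continuous_ellipticK_integrand (h0.trans hxy.le) h1).continuousOn (fun φ _ => ?_)
    ⟨Real.pi / 2, ⟨by positivity, le_rfl⟩, ?_⟩
  · have := Real.sqrt_pos.mpr (hpos φ)
    gcongr
  · have := Real.sqrt_pos.mpr (hpos (Real.pi / 2))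
    simp only [Real.sin_pi_div_two, one_pow, mul_one] at *
    refine one_div_lt_one_div_of_lt this (Real.sqrt_lt_sqrt ?_ (by linarith))
    have := hpos (Real.pi / 2)
    simp only [Real.sin_pi_div_two, one_pow, mul_one] at this
    exact this.le

/-- `K` is strictly increasing, so `K(√(1 - x²)) / K(x)` is strictly decreasing. -/
lemma IsModulusOfNome.unique {x y p : ℝ} (hx : IsModulusOfNome x p) (hy : IsModulusOfNome y p) :
    x = y := by
  wlog hxy : x < y generalizing x y
  · rcases lt_or_eq_of_le (not_lt.mp hxy) with h | h
    · exact (this hy hx h).symm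
    · exact h.symm
  exfalso
  obtain ⟨hx0, hx1, hxp⟩ := hx
  obtain ⟨hy0, hy1, hyp⟩ := hy
  have h1 := Real.exp_injective (hxp.symm.trans hyp)
  have hKx := ellipticK_pos hx0.le hx1
  have hKy := ellipticK_pos hy0.le hy1
  have hlt := ellipticK_lt hx0.le hxy hy1
  have hx' : √(1 - x ^ 2) < 1 := by
    rw [Real.sqrt_lt' one_pos]; nlinarith
  have hlt' : ellipticK √(1 - y ^ 2) < ellipticK √(1 - x ^ 2) :=
    ellipticK_lt (Real.sqrt_nonneg _) (Real.sqrt_lt_sqrt (by nlinarith) (by nlinarith)) hx'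
  have hKy' := ellipticK_pos (Real.sqrt_nonneg (1 - y ^ 2)) (by
    rw [Real.sqrt_lt' one_pos]; nlinarith)
  rw [div_eq_div_iff hKx.ne' hKy.ne'] at h1
  have h2 : ellipticK √(1 - x ^ 2) * ellipticK y = ellipticK √(1 - y ^ 2) * ellipticK x :=
    mul_left_cancel₀ (neg_ne_zero.mpr Real.pi_ne_zero) (by linarith)
  have h3 : ellipticK √(1 - y ^ 2) * ellipticK x < ellipticK √(1 - x ^ 2) * ellipticK y :=
    mul_lt_mul'' hlt' hlt hKy'.le hKx.le
  linarith

/-! ### Quadratic relations between theta constants -/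

/-- The pairs of integers as the disjoint union of the pairs of equal parity
`(a + b, a - b)` and those of opposite parity `(a + b + 1, a - b)`. -/
def paritySplit : (ℤ × ℤ) ⊕ (ℤ × ℤ) ≃ ℤ × ℤ where
  toFun := Sum.elim (fun p => (p.1 + p.2, p.1 - p.2)) fun p => (p.1 + p.2 + 1, p.1 - p.2)
  invFun p := if Even (p.1 + p.2) then Sum.inl ((p.1 + p.2) / 2, (p.1 - p.2) / 2)
    else Sum.inr ((p.1 + p.2 - 1) / 2, (p.1 - p.2 - 1) / 2)
  left_inv := by
    rintro (⟨a, b⟩ | ⟨a, b⟩)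
    · have h : Even ((a + b) + (a - b)) := ⟨a, by ring⟩
      dsimp only [Sum.elim_inl]
      rw [if_pos h]
      exact congrArg Sum.inl (Prod.ext (by dsimp only; omega) (by dsimp only; omega))
    · have h : ¬Even ((a + b + 1) + (a - b)) := by
        rw [Int.not_even_iff_odd]; exact ⟨a, by ring⟩
      dsimp only [Sum.elim_inr]
      rw [if_neg h]
      exact congrArg Sum.inr (Prod.ext (by dsimp only; omega) (by dsimp only; omega))
  right_inv := by
    rintro ⟨m, n⟩
    by_cases h : Even (m + n)
    · simp only [if_pos h, Sum.elim_inl]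
      rw [Int.even_iff] at h
      ext <;> simp only <;> omega
    · simp only [if_neg h, Sum.elim_inr]
      rw [Int.even_iff] at h
      ext <;> simp only <;> omega

lemma tsum_eq_tsum_parity {F : ℤ × ℤ → ℂ} (hF : Summable F) :
    ∑' p, F p = (∑' p : ℤ × ℤ, F (p.1 + p.2, p.1 - p.2))
      + ∑' p : ℤ × ℤ, F (p.1 + p.2 + 1, p.1 - p.2) := by
  have h := paritySplit.summable_iff.mpr hF
  rw [← paritySplit.tsum_eq F]
  exact Summable.tsum_sum (f := fun s => F (paritySplit s)) (h.comp_injective Sum.inl_injective)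
    (h.comp_injective Sum.inr_injective)

/-- `θ₄(0 | t) = ∑_{n ∈ ℤ} (-1)ⁿ e^{πitn²}`. -/
noncomputable def theta4Const (t : ℂ) : ℂ :=
  ∑' n : ℤ, (-1) ^ n * Complex.exp (Real.pi * Complex.I * t * (n : ℂ) ^ 2)

/-- The product of two theta series, with terms `f₁, f₂` at `t`, when the products of terms
at `(a + b, a - b)` and at `(a + b + 1, a - b)` factor into terms of `g₁, g₂` and `h₁, h₂`. -/
lemma tsum_mul_tsum_parity {f₁ f₂ g₁ g₂ h₁ h₂ : ℤ → ℂ}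
    (hf₁ : Summable fun n => ‖f₁ n‖) (hf₂ : Summable fun n => ‖f₂ n‖)
    (hg₁ : Summable fun n => ‖g₁ n‖) (hg₂ : Summable fun n => ‖g₂ n‖)
    (hh₁ : Summable fun n => ‖h₁ n‖) (hh₂ : Summable fun n => ‖h₂ n‖)
    (e₁ : ∀ a b, f₁ (a + b) * f₂ (a - b) = g₁ a * g₂ b)
    (e₂ : ∀ a b, f₁ (a + b + 1) * f₂ (a - b) = h₁ a * h₂ b) :
    (∑' n, f₁ n) * ∑' n, f₂ n
      = (∑' n, g₁ n) * (∑' n, g₂ n) + (∑' n, h₁ n) * ∑' n, h₂ n := by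
  rw [tsum_mul_tsum_of_summable_norm hf₁ hf₂, tsum_mul_tsum_of_summable_norm hg₁ hg₂,
    tsum_mul_tsum_of_summable_norm hh₁ hh₂,
    tsum_eq_tsum_parity (summable_mul_of_summable_norm hf₁ hf₂)]
  simp only [e₁, e₂]

lemma theta3_term_eq (t : ℂ) (n : ℤ) :
    Complex.exp (Real.pi * Complex.I * t * (n : ℂ) ^ 2) = jacobiTheta₂_term n 0 t := by
  rw [jacobiTheta₂_term]; congr 1; ring

lemma theta4_const_term_eq (t : ℂ) (n : ℤ) :
    (-1) ^ n * Complex.exp (Real.pi * Complex.I * t * (n : ℂ) ^ 2)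
      = jacobiTheta₂_term n (1 / 2) t := by
  rw [jacobiTheta₂_term, ← Complex.exp_pi_mul_I, ← Complex.exp_int_mul, ← Complex.exp_add]
  congr 1; ring

lemma theta2_term_eq (t : ℂ) (n : ℤ) :
    Complex.exp (Real.pi * Complex.I * t * ((n : ℂ) + 1 / 2) ^ 2)
      = Complex.exp (Real.pi * Complex.I * t / 4) * jacobiTheta₂_term n (t / 2) t := by
  rw [jacobiTheta₂_term, ← Complex.exp_add]; congr 1; ring

lemma theta3Const_eq (t : ℂ) : theta3Const t = jacobiTheta₂ 0 t := tsum_congr (theta3_term_eq t)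

lemma theta4Const_eq (t : ℂ) : theta4Const t = jacobiTheta₂ (1 / 2) t :=
  tsum_congr (theta4_const_term_eq t)

lemma theta2Const_eq (t : ℂ) : theta2Const t
    = Complex.exp (Real.pi * Complex.I * t / 4) * jacobiTheta₂ (t / 2) t := by
  rw [theta2Const, jacobiTheta₂, ← tsum_mul_left]
  exact tsum_congr (theta2_term_eq t)

lemma theta4_zero_eq (τ : ℂ) : theta4 τ 0 = theta4Const (2 * τ) := by
  rw [theta4_eq_jacobiTheta₂, theta4Const_eq, zero_div, add_zero]

lemma summable_theta3_term {t : ℂ} (ht : 0 < t.im) :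
    Summable fun n : ℤ => ‖Complex.exp (Real.pi * Complex.I * t * (n : ℂ) ^ 2)‖ := by
  simp_rw [theta3_term_eq]
  exact ((summable_jacobiTheta₂_term_iff _ _).mpr ht).norm

lemma summable_theta2_term {t : ℂ} (ht : 0 < t.im) :
    Summable fun n : ℤ => ‖Complex.exp (Real.pi * Complex.I * t * ((n : ℂ) + 1 / 2) ^ 2)‖ := by
  simp_rw [theta2_term_eq]
  exact (((summable_jacobiTheta₂_term_iff _ _).mpr ht).mul_left _).norm

lemma norm_neg_one_zpow_mul (n : ℤ) (z : ℂ) : ‖(-1) ^ n * z‖ = ‖z‖ := by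
  rw [norm_mul, norm_zpow, norm_neg, norm_one, one_zpow, one_mul]

lemma exp_mul_exp_even (t : ℂ) (a b : ℤ) :
    Complex.exp (Real.pi * Complex.I * t * ((a + b : ℤ) : ℂ) ^ 2)
        * Complex.exp (Real.pi * Complex.I * t * ((a - b : ℤ) : ℂ) ^ 2)
      = Complex.exp (Real.pi * Complex.I * (2 * t) * (a : ℂ) ^ 2)
        * Complex.exp (Real.pi * Complex.I * (2 * t) * (b : ℂ) ^ 2) := by
  rw [← Complex.exp_add, ← Complex.exp_add]
  push_cast
  congr 1; ring

lemma exp_mul_exp_odd (t : ℂ) (a b : ℤ) :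
    Complex.exp (Real.pi * Complex.I * t * ((a + b + 1 : ℤ) : ℂ) ^ 2)
        * Complex.exp (Real.pi * Complex.I * t * ((a - b : ℤ) : ℂ) ^ 2)
      = Complex.exp (Real.pi * Complex.I * (2 * t) * ((a : ℂ) + 1 / 2) ^ 2)
        * Complex.exp (Real.pi * Complex.I * (2 * t) * ((b : ℂ) + 1 / 2) ^ 2) := by
  rw [← Complex.exp_add, ← Complex.exp_add]
  push_cast
  congr 1; ring

theorem theta3Const_sq {t : ℂ} (ht : 0 < t.im) :
    theta3Const t ^ 2 = theta3Const (2 * t) ^ 2 + theta2Const (2 * t) ^ 2 := by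
  have ht2 := im_two_mul_pos ht
  rw [sq, sq, sq]
  exact tsum_mul_tsum_parity (summable_theta3_term ht) (summable_theta3_term ht)
    (summable_theta3_term ht2) (summable_theta3_term ht2) (summable_theta2_term ht2)
    (summable_theta2_term ht2) (exp_mul_exp_even t) (exp_mul_exp_odd t)

lemma neg_one_zpow_sub (a b : ℤ) : (-1 : ℂ) ^ (a - b) = (-1) ^ a * (-1) ^ b := by
  rw [zpow_sub₀ (neg_ne_zero.mpr one_ne_zero), div_eq_mul_inv, ← inv_zpow, inv_neg, inv_one]

lemma neg_one_zpow_mul_self (a : ℤ) : (-1 : ℂ) ^ a * (-1) ^ a = 1 := by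
  rw [← mul_zpow, neg_one_mul, neg_neg, one_zpow]

theorem theta4Const_sq {t : ℂ} (ht : 0 < t.im) :
    theta4Const t ^ 2 = theta3Const (2 * t) ^ 2 - theta2Const (2 * t) ^ 2 := by
  have ht2 := im_two_mul_pos ht
  have h := tsum_mul_tsum_parity
    (f₁ := fun n : ℤ => (-1) ^ n * Complex.exp (Real.pi * Complex.I * t * (n : ℂ) ^ 2))
    (f₂ := fun n : ℤ => (-1) ^ n * Complex.exp (Real.pi * Complex.I * t * (n : ℂ) ^ 2))
    (h₂ := fun n : ℤ => -Complex.exp (Real.pi * Complex.I * (2 * t) * ((n : ℂ) + 1 / 2) ^ 2))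
    (by simpa only [norm_neg_one_zpow_mul] using summable_theta3_term ht)
    (by simpa only [norm_neg_one_zpow_mul] using summable_theta3_term ht)
    (summable_theta3_term ht2) (summable_theta3_term ht2) (summable_theta2_term ht2)
    (by simpa only [norm_neg] using summable_theta2_term ht2)
    (fun a b => by
      rw [← exp_mul_exp_even, zpow_add₀ (neg_ne_zero.mpr one_ne_zero), neg_one_zpow_sub]
      linear_combination (Complex.exp (Real.pi * Complex.I * t * ((a + b : ℤ) : ℂ) ^ 2)
        * Complex.exp (Real.pi * Complex.I * t * ((a - b : ℤ) : ℂ) ^ 2))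
        * ((-1) ^ b * (-1) ^ b * neg_one_zpow_mul_self a + neg_one_zpow_mul_self b))
    (fun a b => by
      rw [mul_neg, ← exp_mul_exp_odd, zpow_add₀ (neg_ne_zero.mpr one_ne_zero),
        zpow_add₀ (neg_ne_zero.mpr one_ne_zero), neg_one_zpow_sub, zpow_one]
      linear_combination -(Complex.exp (Real.pi * Complex.I * t * ((a + b + 1 : ℤ) : ℂ) ^ 2)
        * Complex.exp (Real.pi * Complex.I * t * ((a - b : ℤ) : ℂ) ^ 2))
        * ((-1) ^ b * (-1) ^ b * neg_one_zpow_mul_self a + neg_one_zpow_mul_self b))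
  rw [tsum_neg, mul_neg, ← sub_eq_add_neg] at h
  rw [sq, sq, sq]
  exact h

theorem theta3Const_mul_theta4Const {t : ℂ} (ht : 0 < t.im) :
    theta3Const t * theta4Const t = theta4Const (2 * t) ^ 2 := by
  have ht2 := im_two_mul_pos ht
  have s4 : ∀ {u : ℂ}, 0 < u.im → Summable fun n : ℤ =>
      ‖(-1) ^ n * Complex.exp (Real.pi * Complex.I * u * (n : ℂ) ^ 2)‖ := fun hu => by
    simpa only [norm_neg_one_zpow_mul] using summable_theta3_term hu
  have s2 : Summable fun n : ℤ =>
      ‖(-1) ^ n * Complex.exp (Real.pi * Complex.I * (2 * t) * ((n : ℂ) + 1 / 2) ^ 2)‖ := by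
    simpa only [norm_neg_one_zpow_mul] using summable_theta2_term ht2
  have h := tsum_mul_tsum_parity (summable_theta3_term ht) (s4 ht) (s4 ht2) (s4 ht2) s2 s2
    (fun a b => by
      rw [neg_one_zpow_sub]
      linear_combination ((-1) ^ a * (-1) ^ b) * exp_mul_exp_even t a b)
    (fun a b => by
      rw [neg_one_zpow_sub]
      linear_combination ((-1) ^ a * (-1) ^ b) * exp_mul_exp_odd t a b)
  -- The alternating version of `θ₂` vanishes: `n ↦ -1 - n` changes the sign of its terms.
  have h0 : ∑' n : ℤ,
      (-1) ^ n * Complex.exp (Real.pi * Complex.I * (2 * t) * ((n : ℂ) + 1 / 2) ^ 2) = 0 := by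
    have h1 := (Equiv.subLeft (-1 : ℤ)).tsum_eq fun n : ℤ =>
      (-1) ^ n * Complex.exp (Real.pi * Complex.I * (2 * t) * ((n : ℂ) + 1 / 2) ^ 2)
    have h2 : ∀ n : ℤ, (-1 : ℂ) ^ (Equiv.subLeft (-1 : ℤ) n)
        * Complex.exp (Real.pi * Complex.I * (2 * t)
          * (((Equiv.subLeft (-1 : ℤ) n : ℤ) : ℂ) + 1 / 2) ^ 2)
        = -((-1) ^ n
          * Complex.exp (Real.pi * Complex.I * (2 * t) * ((n : ℂ) + 1 / 2) ^ 2)) := fun n => by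
      rw [Equiv.subLeft_apply, neg_one_zpow_sub]
      push_cast
      rw [show ((-1 : ℂ) - n + 1 / 2) ^ 2 = (n + 1 / 2) ^ 2 by ring]
      norm_num
    rw [tsum_congr h2, tsum_neg] at h1
    linear_combination -h1 / 2
  rw [h0, mul_zero, add_zero] at h
  rw [sq]
  exact h

theorem theta4Const_ne_zero {t : ℂ} (ht : 0 < t.im) : theta4Const t ≠ 0 := by
  have h := theta4_zero_ne_zero (τ := t / 2) (by simpa using ht)
  rwa [theta4_zero_eq, mul_div_cancel₀ _ (two_ne_zero' ℂ)] at h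

/-- A zero of `θ₃` would be a zero of `θ₄` at `2t`. -/
theorem theta3Const_ne_zero {t : ℂ} (ht : 0 < t.im) : theta3Const t ≠ 0 := by
  intro h
  have h1 := theta3Const_mul_theta4Const ht
  rw [h, zero_mul] at h1
  exact pow_ne_zero 2 (theta4Const_ne_zero (im_two_mul_pos ht)) h1.symm

theorem theta4_zero_sq {τ : ℂ} (hτ : 0 < τ.im) :
    theta4 τ 0 ^ 2 = 2 / Real.pi * (1 - modulus (4 * τ)) * quarterPeriod (4 * τ) := by
  have h2 := im_two_mul_pos hτ
  have h4 : 2 * (2 * τ) = 4 * τ := by ring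
  have h3 := theta3Const_ne_zero (im_two_mul_pos h2)
  have hpi : (Real.pi : ℂ) ≠ 0 := Complex.ofReal_ne_zero.mpr Real.pi_ne_zero
  rw [theta4_zero_eq, theta4Const_sq h2, h4, modulus, quarterPeriod]
  rw [h4] at h3
  field_simp

/-! ### Theta constants on the imaginary axis -/

/-- The real number `θ₂(0 | is)`. -/
noncomputable def realTheta2 (s : ℝ) : ℝ :=
  ∑' n : ℤ, Real.exp (-Real.pi * s * ((n : ℝ) + 1 / 2) ^ 2)

/-- The real number `θ₃(0 | is)`. -/
noncomputable def realTheta3 (s : ℝ) : ℝ := ∑' n : ℤ, Real.exp (-Real.pi * s * (n : ℝ) ^ 2)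

/-- The real number `θ₄(0 | is)`. -/
noncomputable def realTheta4 (s : ℝ) : ℝ :=
  ∑' n : ℤ, (-1) ^ n * Real.exp (-Real.pi * s * (n : ℝ) ^ 2)

lemma exp_I_mul (s r : ℝ) : Complex.exp (Real.pi * Complex.I * (Complex.I * s) * (r : ℂ) ^ 2)
    = (Real.exp (-Real.pi * s * r ^ 2) : ℂ) := by
  rw [Complex.ofReal_exp]
  congr 1
  push_cast
  linear_combination (Real.pi * s * (r : ℂ) ^ 2) * Complex.I_sq

lemma theta2Const_I_mul (s : ℝ) : theta2Const (Complex.I * s) = realTheta2 s := by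
  rw [theta2Const, realTheta2, Complex.ofReal_tsum]
  refine tsum_congr fun n => ?_
  rw [← exp_I_mul]
  push_cast
  rfl

lemma theta3Const_I_mul (s : ℝ) : theta3Const (Complex.I * s) = realTheta3 s := by
  rw [theta3Const, realTheta3, Complex.ofReal_tsum]
  refine tsum_congr fun n => ?_
  rw [← exp_I_mul]
  push_cast
  rfl

lemma theta4Const_I_mul (s : ℝ) : theta4Const (Complex.I * s) = realTheta4 s := by
  rw [theta4Const, realTheta4, Complex.ofReal_tsum]
  refine tsum_congr fun n => ?_
  rw [Complex.ofReal_mul, ← exp_I_mul]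
  push_cast
  rfl

lemma im_I_mul_pos {s : ℝ} (hs : 0 < s) : 0 < (Complex.I * (s : ℂ)).im := by simpa using hs

lemma two_mul_I_mul (s : ℝ) : 2 * (Complex.I * (s : ℂ)) = Complex.I * ((2 * s : ℝ) : ℂ) := by
  push_cast; ring

lemma realTheta3_sq {s : ℝ} (hs : 0 < s) :
    realTheta3 s ^ 2 = realTheta3 (2 * s) ^ 2 + realTheta2 (2 * s) ^ 2 := by
  have h := theta3Const_sq (im_I_mul_pos hs)
  simp only [two_mul_I_mul, theta3Const_I_mul, theta2Const_I_mul] at h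
  exact_mod_cast h

lemma realTheta4_sq {s : ℝ} (hs : 0 < s) :
    realTheta4 s ^ 2 = realTheta3 (2 * s) ^ 2 - realTheta2 (2 * s) ^ 2 := by
  have h := theta4Const_sq (im_I_mul_pos hs)
  simp only [two_mul_I_mul, theta3Const_I_mul, theta2Const_I_mul, theta4Const_I_mul] at h
  exact_mod_cast h

lemma realTheta3_mul_realTheta4 {s : ℝ} (hs : 0 < s) :
    realTheta3 s * realTheta4 s = realTheta4 (2 * s) ^ 2 := by
  have h := theta3Const_mul_theta4Const (im_I_mul_pos hs)
  simp only [two_mul_I_mul, theta3Const_I_mul, theta4Const_I_mul] at h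
  exact_mod_cast h

lemma realTheta3_pos {s : ℝ} (hs : 0 < s) : 0 < realTheta3 s := by
  have h : Summable fun n : ℤ => Real.exp (-Real.pi * s * (n : ℝ) ^ 2) := by
    refine (summable_theta3_term (im_I_mul_pos hs)).congr fun n => ?_
    rw [show (n : ℂ) = ((n : ℝ) : ℂ) by push_cast; rfl, exp_I_mul, Complex.norm_real,
      Real.norm_of_nonneg (Real.exp_pos _).le]
  exact h.tsum_pos (fun _ => (Real.exp_pos _).le) 0 (Real.exp_pos _)

lemma realTheta2_pos {s : ℝ} (hs : 0 < s) : 0 < realTheta2 s := by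
  have h : Summable fun n : ℤ => Real.exp (-Real.pi * s * ((n : ℝ) + 1 / 2) ^ 2) := by
    refine (summable_theta2_term (im_I_mul_pos hs)).congr fun n => ?_
    rw [show (n : ℂ) + 1 / 2 = ((n + 1 / 2 : ℝ) : ℂ) by push_cast; rfl, exp_I_mul,
      Complex.norm_real, Real.norm_of_nonneg (Real.exp_pos _).le]
  exact h.tsum_pos (fun _ => (Real.exp_pos _).le) 0 (Real.exp_pos _)

lemma neg_I_mul_I_mul_cpow {s : ℝ} (hs : 0 < s) :
    (-Complex.I * (Complex.I * s)) ^ (1 / 2 : ℂ) = (√s : ℂ) := by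
  rw [show -Complex.I * (Complex.I * (s : ℂ)) = s by linear_combination -(s : ℂ) * Complex.I_sq,
    Real.sqrt_eq_rpow, Complex.ofReal_cpow hs.le]
  push_cast
  rfl

lemma neg_one_div_I_mul (s : ℝ) : -1 / (Complex.I * (s : ℂ)) = Complex.I * ((1 / s : ℝ) : ℂ) := by
  rw [← div_div, neg_div, Complex.div_I]
  push_cast
  ring

/-- Jacobi's imaginary transformation of `θ₃`. -/
lemma realTheta3_inv {s : ℝ} (hs : 0 < s) : realTheta3 s = realTheta3 (1 / s) / √s := by
  have h := jacobiTheta₂_functional_equation 0 (Complex.I * s)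
  rw [neg_I_mul_I_mul_cpow hs, neg_one_div_I_mul, zero_div, ← theta3Const_eq, ← theta3Const_eq,
    theta3Const_I_mul, theta3Const_I_mul] at h
  have h1 : (realTheta3 s : ℂ) = ((realTheta3 (1 / s) / √s : ℝ) : ℂ) := by
    rw [h]
    push_cast
    simp
    ring
  exact_mod_cast h1

/-- Jacobi's imaginary transformation of `θ₄` into `θ₂`. -/
lemma realTheta4_inv {s : ℝ} (hs : 0 < s) : realTheta4 s = realTheta2 (1 / s) / √s := by
  have hs' : (s : ℂ) ≠ 0 := Complex.ofReal_ne_zero.mpr hs.ne'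
  have h := jacobiTheta₂_functional_equation (1 / 2) (Complex.I * s)
  have e1 : (1 / 2 : ℂ) / (Complex.I * s) = -(Complex.I * ((1 / s : ℝ) : ℂ) / 2) := by
    rw [← neg_one_div_I_mul]; ring
  have e2 : -Real.pi * Complex.I * (1 / 2 : ℂ) ^ 2 / (Complex.I * s)
      = Real.pi * Complex.I * (Complex.I * ((1 / s : ℝ) : ℂ)) / 4 := by
    rw [← neg_one_div_I_mul]; ring
  rw [neg_I_mul_I_mul_cpow hs, neg_one_div_I_mul, e1, e2, jacobiTheta₂_neg_left, mul_assoc,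
    ← theta2Const_eq, ← theta4Const_eq, theta4Const_I_mul, theta2Const_I_mul] at h
  have h1 : (realTheta4 s : ℂ) = ((realTheta2 (1 / s) / √s : ℝ) : ℂ) := by
    rw [h]
    push_cast
    ring
  exact_mod_cast h1

lemma realTheta4_pos {s : ℝ} (hs : 0 < s) : 0 < realTheta4 s := by
  rw [realTheta4_inv hs]
  exact div_pos (realTheta2_pos (by positivity)) (Real.sqrt_pos.mpr hs)

lemma tendsto_realTheta3 : Tendsto realTheta3 atTop (𝓝 1) := by
  have h1 : Tendsto (fun s : ℝ => Real.exp (-Real.pi * s)) atTop (𝓝 0) :=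
    Real.tendsto_exp_atBot.comp
      (tendsto_id.const_mul_atTop_of_neg (neg_lt_zero.mpr Real.pi_pos))
  have h2 : Tendsto (fun s : ℝ => 2 / (1 - Real.exp (-Real.pi * s)) * Real.exp (-Real.pi * s))
      atTop (𝓝 0) := by
    have := ((tendsto_const_nhds (x := (2 : ℝ))).div (h1.const_sub 1) (by norm_num)).mul h1
    rwa [mul_zero] at this
  rw [tendsto_iff_norm_sub_tendsto_zero]
  refine squeeze_zero' (Eventually.of_forall fun _ => norm_nonneg _) ?_ h2
  filter_upwards [eventually_gt_atTop 0] with s hs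
  have h3 := norm_jacobiTheta_sub_one_le (im_I_mul_pos hs)
  rw [jacobiTheta_eq_jacobiTheta₂, ← theta3Const_eq, theta3Const_I_mul, ← Complex.ofReal_one,
    ← Complex.ofReal_sub, Complex.norm_real] at h3
  simpa using h3

lemma tendsto_realTheta4_sq : Tendsto (fun s => realTheta4 s ^ 2) atTop (𝓝 1) := by
  have h2 : Tendsto (fun s : ℝ => 2 * s) atTop atTop := tendsto_id.const_mul_atTop two_pos
  have h := (((tendsto_realTheta3.comp h2).pow 2).const_mul 2).sub (tendsto_realTheta3.pow 2)
  norm_num at h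
  refine h.congr' ?_
  filter_upwards [eventually_gt_atTop 0] with s hs
  have e1 := realTheta3_sq hs
  have e2 := realTheta4_sq hs
  change 2 * realTheta3 (2 * s) ^ 2 - realTheta3 s ^ 2 = realTheta4 s ^ 2
  linarith

/-- The sequence `(θ₃²(2ⁿs), θ₄²(2ⁿs))` consists of steps of the arithmetic-geometric mean, and it
tends to `(1, 1)`. -/
theorem gaussIntegral_theta {s : ℝ} (hs : 0 < s) :
    gaussIntegral (realTheta3 s ^ 2) (realTheta4 s ^ 2) = Real.pi / 2 := by
  have hstep : ∀ s : ℝ, 0 < s → gaussIntegral (realTheta3 (2 * s) ^ 2) (realTheta4 (2 * s) ^ 2)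
      = gaussIntegral (realTheta3 s ^ 2) (realTheta4 s ^ 2) := fun s hs => by
    have h3 := realTheta3_pos hs
    have h4 := realTheta4_pos hs
    rw [← gaussIntegral_agm (pow_pos h3 2) (pow_pos h4 2), ← mul_pow, Real.sqrt_sq (by positivity),
      realTheta3_mul_realTheta4 hs]
    congr 1
    linarith [realTheta3_sq hs, realTheta4_sq hs]
  have hn : ∀ n : ℕ, gaussIntegral (realTheta3 (2 ^ n * s) ^ 2) (realTheta4 (2 ^ n * s) ^ 2)
      = gaussIntegral (realTheta3 s ^ 2) (realTheta4 s ^ 2) := fun n => by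
    induction n with
    | zero => simp
    | succ n ih =>
      rw [show (2 : ℝ) ^ (n + 1) * s = 2 * (2 ^ n * s) by ring, hstep _ (by positivity), ih]
  have hT : Tendsto (fun n : ℕ => (2 : ℝ) ^ n * s) atTop atTop :=
    (tendsto_pow_atTop_atTop_of_one_lt one_lt_two).atTop_mul_const hs
  have h3 : Tendsto (fun n : ℕ => realTheta3 (2 ^ n * s) ^ 2) atTop (𝓝 1) := by
    simpa using (tendsto_realTheta3.comp hT).pow 2
  have hlim := tendsto_gaussIntegral_one
    (fun n : ℕ => pow_pos (realTheta3_pos (by positivity : 0 < 2 ^ n * s)) 2)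
    (fun n : ℕ => pow_pos (realTheta4_pos (by positivity : 0 < 2 ^ n * s)) 2)
    h3 (tendsto_realTheta4_sq.comp hT)
  simp_rw [hn] at hlim
  exact tendsto_nhds_unique tendsto_const_nhds hlim

/-- Jacobi's identity `θ₃⁴ = θ₂⁴ + θ₄⁴`. -/
lemma realTheta_jacobi {s : ℝ} (hs : 0 < s) :
    (realTheta2 s ^ 2) ^ 2 + (realTheta4 s ^ 2) ^ 2 = (realTheta3 s ^ 2) ^ 2 := by
  have h0 : 0 < s / 2 := by positivity
  have h1 := realTheta3_sq h0
  have h2 := realTheta4_sq h0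
  have h3 := realTheta3_mul_realTheta4 h0
  rw [mul_div_cancel₀ _ (two_ne_zero' ℝ)] at h1 h2 h3
  rw [← h3, mul_pow, h1, h2]
  ring

/-- The elliptic modulus `θ₂² / θ₃²` at `is`. -/
noncomputable def realModulus (s : ℝ) : ℝ := realTheta2 s ^ 2 / realTheta3 s ^ 2

lemma realModulus_sq_add {s : ℝ} (hs : 0 < s) :
    realModulus s ^ 2 + (realTheta4 s ^ 2 / realTheta3 s ^ 2) ^ 2 = 1 := by
  have h3 := realTheta3_pos hs
  rw [realModulus, div_pow, div_pow, ← add_div, realTheta_jacobi hs, div_self (by positivity)]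

lemma realModulus_pos {s : ℝ} (hs : 0 < s) : 0 < realModulus s :=
  div_pos (pow_pos (realTheta2_pos hs) 2) (pow_pos (realTheta3_pos hs) 2)

lemma realModulus_lt_one {s : ℝ} (hs : 0 < s) : realModulus s < 1 := by
  have h := realModulus_sq_add hs
  have h4 : 0 < (realTheta4 s ^ 2 / realTheta3 s ^ 2) ^ 2 := by
    have := realTheta4_pos hs
    have := realTheta3_pos hs
    positivity
  have := realModulus_pos hs
  nlinarith

/-- By homogeneity and Jacobi's identity, this is `gaussIntegral_theta`. -/
theorem ellipticK_realModulus {s : ℝ} (hs : 0 < s) :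
    ellipticK (realModulus s) = Real.pi / 2 * realTheta3 s ^ 2 := by
  have h3 : 0 < realTheta3 s ^ 2 := pow_pos (realTheta3_pos hs) 2
  rw [ellipticK_eq_gaussIntegral (realModulus_sq_add hs), ← gaussIntegral_theta hs]
  have h := gaussIntegral_smul (a := 1) (b := realTheta4 s ^ 2 / realTheta3 s ^ 2) h3
  rw [mul_one, mul_div_cancel₀ _ h3.ne'] at h
  rw [h, div_mul_cancel₀ _ h3.ne']

/-- The complementary integral, from the imaginary transformation. -/
theorem ellipticK_compl_realModulus {s : ℝ} (hs : 0 < s) :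
    ellipticK √(1 - realModulus s ^ 2) = s * (Real.pi / 2 * realTheta3 s ^ 2) := by
  have h3 : 0 < realTheta3 s ^ 2 := pow_pos (realTheta3_pos hs) 2
  have h3' := (realTheta3_pos hs).ne'
  have hadd := realModulus_sq_add hs
  have hs' : 0 < 1 / s := by positivity
  have hsqrt : √(1 - realModulus s ^ 2) ^ 2 + realModulus s ^ 2 = 1 := by
    rw [Real.sq_sqrt (by rw [← hadd, add_sub_cancel_left]; positivity)]
    ring
  have e3 : realTheta3 (1 / s) ^ 2 = s * realTheta3 s ^ 2 := by
    rw [realTheta3_inv hs, div_pow, Real.sq_sqrt hs.le]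
    field_simp
  have e4 : realTheta4 (1 / s) ^ 2 = s * realTheta2 s ^ 2 := by
    rw [realTheta4_inv hs', one_div_one_div, div_pow, Real.sq_sqrt hs'.le]
    field_simp
  have hG := gaussIntegral_theta hs'
  rw [e3, e4, gaussIntegral_smul hs] at hG
  have h := gaussIntegral_smul (a := 1) (b := realModulus s) h3
  rw [mul_one, realModulus, mul_div_cancel₀ _ h3.ne'] at h
  rw [ellipticK_eq_gaussIntegral hsqrt, realModulus]
  rw [h] at hG
  field_simp at hG ⊢
  linear_combination hG

theorem isModulusOfNome_realModulus {s : ℝ} (hs : 0 < s) :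
    IsModulusOfNome (realModulus s) (Real.exp (-Real.pi * s)) := by
  refine ⟨realModulus_pos hs, realModulus_lt_one hs, ?_⟩
  have h3 : 0 < realTheta3 s ^ 2 := pow_pos (realTheta3_pos hs) 2
  have h3' := (realTheta3_pos hs).ne'
  have hpi := Real.pi_pos
  rw [ellipticK_realModulus hs, ellipticK_compl_realModulus hs]
  congr 1
  field_simp

/-! ### Real nomes -/

/-- If `q` is positive, the real part of `τ` is an integer. -/
lemma exists_int_re_of_qParam_eq {τ : ℂ} {p : ℝ} (hp : 0 < p) (h : qParam τ = (p : ℂ)) :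
    (∃ N : ℤ, τ = Complex.I * τ.im + N) ∧ p = Real.exp (-2 * Real.pi * τ.im) := by
  have hpi : (Real.pi : ℂ) ≠ 0 := Complex.ofReal_ne_zero.mpr Real.pi_ne_zero
  have h1 : p = Real.exp (-2 * Real.pi * τ.im) := by
    have := congrArg norm h
    rw [qParam, Complex.norm_exp, Complex.norm_real, Real.norm_of_nonneg hp.le] at this
    rw [← this]
    congr 1
    simp [Complex.mul_re, Complex.mul_im]
  refine ⟨?_, h1⟩
  rw [h1, qParam, Complex.ofReal_exp, Complex.exp_eq_exp_iff_exists_int] at h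
  obtain ⟨N, hN⟩ := h
  refine ⟨N, ?_⟩
  have h2 : (2 * Real.pi * Complex.I) * τ
      = (2 * Real.pi * Complex.I) * (Complex.I * τ.im + N) := by
    rw [hN]
    push_cast
    linear_combination (-2 * Real.pi * (τ.im : ℂ)) * Complex.I_sq
  exact mul_left_cancel₀ (mul_ne_zero (mul_ne_zero two_ne_zero hpi) Complex.I_ne_zero) h2

lemma theta3Const_add_four_mul (t : ℂ) (N : ℤ) : theta3Const (t + 4 * N) = theta3Const t := by
  refine tsum_congr fun n => ?_
  rw [Complex.exp_eq_exp_iff_exists_int]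
  exact ⟨2 * N * n ^ 2, by push_cast; ring⟩

lemma theta2Const_add_four_mul (t : ℂ) (N : ℤ) :
    theta2Const (t + 4 * N) ^ 2 = theta2Const t ^ 2 := by
  have h : theta2Const (t + 4 * N) = Complex.exp (Real.pi * Complex.I * N) * theta2Const t := by
    rw [theta2Const, theta2Const, ← tsum_mul_left]
    refine tsum_congr fun n => ?_
    rw [← Complex.exp_add, Complex.exp_eq_exp_iff_exists_int]
    exact ⟨2 * N * (n ^ 2 + n), by push_cast; ring⟩
  rw [h, mul_pow, ← Complex.exp_nat_mul,
    show ((2 : ℕ) : ℂ) * (Real.pi * Complex.I * N) = N * (2 * Real.pi * Complex.I) by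
      push_cast; ring, Complex.exp_int_mul_two_pi_mul_I, one_mul]

lemma theta4_zero_add_int (τ : ℂ) (N : ℤ) : theta4 (τ + N) 0 = theta4 τ 0 := by
  have h : qParam (τ + N) = qParam τ := by
    rw [qParam, qParam, Complex.exp_eq_exp_iff_exists_int]
    exact ⟨N, by ring⟩
  simp only [theta4, h]

/-- The case `0 < q < 1`: `τ` is purely imaginary up to an integer, which changes none of the three
functions, and the modulus belonging to `q²` is `realModulus (4 Im τ)`. -/
theorem real_nome {τ : ℂ} (hτ : 0 < τ.im) {p : ℝ} (hp : 0 < p) (hq : qParam τ = (p : ℂ)) :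
    (∃! x : ℝ, IsModulusOfNome x (p ^ 2)) ∧
      ∀ x : ℝ, IsModulusOfNome x (p ^ 2) →
        modulus (4 * τ) = (x : ℂ) ∧ quarterPeriod (4 * τ) = (ellipticK x : ℂ) ∧
          theta4 τ 0 = ((√(2 / Real.pi * (1 - x) * ellipticK x) : ℝ) : ℂ) := by
  obtain ⟨⟨N, hN⟩, hpe⟩ := exists_int_re_of_qParam_eq hp hq
  set s : ℝ := 4 * τ.im with hs_def
  have hs : 0 < s := by positivity
  have hp2 : p ^ 2 = Real.exp (-Real.pi * s) := by
    rw [hpe, ← Real.exp_nat_mul, hs_def]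
    congr 1
    push_cast
    ring
  have hmod := isModulusOfNome_realModulus hs
  rw [hp2]
  refine ⟨⟨realModulus s, hmod, fun y hy => hy.unique hmod⟩, fun x hx => ?_⟩
  obtain rfl := hx.unique hmod
  have h4 : 4 * τ = Complex.I * (s : ℂ) + 4 * N := by
    rw [hs_def]
    push_cast
    linear_combination 4 * hN
  have h3 : 0 < realTheta3 s := realTheta3_pos hs
  refine ⟨?_, ?_, ?_⟩
  · rw [h4, modulus, theta3Const_add_four_mul, theta2Const_add_four_mul, theta2Const_I_mul,
      theta3Const_I_mul, realModulus]
    push_cast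
    rfl
  · rw [h4, quarterPeriod, theta3Const_add_four_mul, theta3Const_I_mul, ellipticK_realModulus hs]
    push_cast
    rfl
  · have hs2 : 0 < s / 2 := by positivity
    have h5 : theta4 τ 0 = realTheta4 (s / 2) := by
      rw [hN, theta4_zero_add_int, theta4_zero_eq, ← theta4Const_I_mul, hs_def]
      congr 1
      push_cast
      ring
    have h6 := realTheta4_sq hs2
    rw [mul_div_cancel₀ _ (two_ne_zero' ℝ)] at h6
    have h7 : 2 / Real.pi * (1 - realModulus s) * ellipticK (realModulus s)
        = realTheta4 (s / 2) ^ 2 := by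
      rw [ellipticK_realModulus hs, h6, realModulus]
      have := Real.pi_pos
      field_simp
    rw [h5, h7, Real.sqrt_sq (realTheta4_pos hs2).le]

end ThetaDeriv

theorem theorem5 :
    -- the Faà di Bruno identity and the recurrence
    (∀ τ : ℂ, 0 < τ.im →
      theta4 τ 0 ≠ 0 ∧
      (∀ k : ℕ, Odd k → theta4Deriv τ k = 0) ∧
      ∀ ν : ℕ, 1 ≤ ν →
        (-1) ^ ν / (2 * 4 ^ ν) * ∑ m ∈ faaTuples (2 * ν), faaTerm τ m
            = ((bernoulli (2 * ν) : ℚ) : ℂ) / (4 * (ν : ℂ))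
              * (eisensteinE (2 * ν) (2 * τ) - eisensteinE (2 * ν) τ) ∧
        theta4Deriv τ (2 * ν)
            = theta4 τ 0 *
              ((-1) ^ (ν + 1) * (2 * 4 ^ ν) * (((bernoulli (2 * ν) : ℚ) : ℂ) / (4 * (ν : ℂ)))
                  * (eisensteinE (2 * ν) (2 * τ) - eisensteinE (2 * ν) τ)
                + ∑ m ∈ (faaTuples (2 * ν)).filter
                    (fun m => ∀ j : Fin (2 * ν), (j : ℕ) + 1 = 2 * ν → m j = 0),
                  faaTerm τ m)) ∧
    -- the polynomial evaluation; the coefficients depend only on `ν`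
    (∀ ν : ℕ, 1 ≤ ν → ∃ c : ℕ → ℕ → ℕ → ℕ → ℕ → ℕ → ℚ, ∀ τ : ℂ, 0 < τ.im →
      -- `w = ϑ₄(0)` is a square root of `(2/π)(1 - x)K`
      (theta4 τ 0 ^ 2 = 2 / Real.pi * (1 - modulus (4 * τ)) * quarterPeriod (4 * τ) ∧
        theta4Deriv τ (2 * ν) = theta4 τ 0 * evalPQR ν c (qParam τ)) ∧
      -- for `0 < q < 1`, with the classical elliptic integral and the positive square root
      (∀ p : ℝ, 0 < p → qParam τ = (p : ℂ) →
        (∃! x : ℝ, IsModulusOfNome x (p ^ 2)) ∧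
        ∀ x : ℝ, IsModulusOfNome x (p ^ 2) →
          modulus (4 * τ) = (x : ℂ) ∧ quarterPeriod (4 * τ) = (ellipticK x : ℂ) ∧
          theta4Deriv τ (2 * ν)
            = ((Real.sqrt (2 / Real.pi * (1 - x) * ellipticK x) : ℝ) : ℂ)
              * evalPQR ν c (qParam τ))) := by
  refine ⟨fun τ hτ => ⟨theta4_zero_ne_zero hτ, fun k hk => theta4Deriv_of_odd τ hk,
    fun ν hν => ?_⟩, fun ν _ => ?_⟩
  · have h2ν : 2 * ν ≠ 0 := by omega
    have h0 := theta4_zero_ne_zero hτ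
    have hsum := sum_faaTerm hτ h2ν
    have hrec := sum_faaTerm_eq τ h2ν
    rw [logTheta_even_eq_eisensteinE hτ hν] at hsum
    have hsign : ((-1 : ℂ) ^ ν) * (-1) ^ ν = 1 := by
      rw [← mul_pow, neg_one_mul, neg_neg, one_pow]
    have h4 : (4 : ℂ) ^ ν ≠ 0 := pow_ne_zero _ (by norm_num)
    refine ⟨?_, ?_⟩
    · rw [hsum, div_mul_eq_mul_div, div_eq_iff (mul_ne_zero two_ne_zero h4), pow_succ]
      linear_combination (2 * 4 ^ ν * (((bernoulli (2 * ν) : ℚ) : ℂ) / (4 * (ν : ℂ))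
        * (eisensteinE (2 * ν) (2 * τ) - eisensteinE (2 * ν) τ))) * hsign
    · rw [hsum] at hrec
      rw [mul_comm (theta4 τ 0), ← div_eq_iff h0]
      linear_combination hrec
  · obtain ⟨c, hc⟩ := exists_evalPQR (isPolyIn_theta4Deriv ν)
    have key : ∀ τ : ℂ, 0 < τ.im →
        theta4Deriv τ (2 * ν) = theta4 τ 0 * evalPQR ν c (qParam τ) := fun τ hτ => by
      rw [← hc ⟨τ, hτ⟩]
      exact (mul_div_cancel₀ _ (theta4_zero_ne_zero hτ)).symm
    refine ⟨c, fun τ hτ => ⟨⟨theta4_zero_sq hτ, key τ hτ⟩, fun p hp hq => ?_⟩⟩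
    obtain ⟨hex, hall⟩ := real_nome hτ hp hq
    refine ⟨hex, fun x hx => ?_⟩
    obtain ⟨hm, hK, hw⟩ := hall x hx
    exact ⟨hm, hK, by rw [key τ hτ, hw]⟩
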